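/- Let $n\ge 3$ and $k\ge 3$. For a $k$-ary $r$-tuple $\mathbf u=(u_0,\dots,u_{r-1})\in\mathbb Z_k^r$ write $\mathbf u^R=(u_{r-1},\dots,u_0)$. An orientable sequence $\mathcal{OS}_k(r)$ of period $p$ is a sequence $(s_i)$ over $\mathbb Z_k$ whose least period is $p$, such that, with $\mathbf s_r(i)=(s_i,\dots,s_{i+r-1})$, $\mathbf s_r(i)=\mathbf s_r(j)$ implies $i\equiv j \pmod p$, and $\mathbf s_r(i)\ne \mathbf s_r(j)^R$ for all $i,j$. The pseudoweight of a tuple is the integer sum of its entries (taken in $\{0,\dots,k-1\}$) with every $0$ replaced by $k/2$. Let $E_k(n-1)$, respectively $H_k(n-1)$, be the set of $k$-ary $n$-tuples of pseudoweight less than, respectively equal to, $kn/2$; they are regarded as edges of the de Bruijn digraph $B_k(n-1)$, the edge $(a_0,\dots,a_{n-1})$ going from $(a_0,\dots,a_{n-2})$ to $(a_1,\dots,a_{n-1})$. Let $\mathcal C_k(n-1)$ be the set of circuits $[\mathbf a]$, $\mathbf a\in H_k(n-1)$, where $[\mathbf a]$ consists of the cyclic shifts of $\mathbf a$. A tuple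 $\mathbf a$ is negasymmetric if $\mathbf a=-\mathbf a^R$; a circuit is negasymmetric if it contains edges $\mathbf a,\mathbf b$ (possibly equal) with $\mathbf a=-\mathbf b^R$. Let $N_i(n,k)$ be the set of negasymmetric circuits in $\mathcal C_k(n-1)$ that contain exactly $i$ negasymmetric $n$-tuples. Let $\delta=1$ if $k$ is odd and $\delta=2$ if $k$ is even, write $n=2^tm$ with $t\ge0$ and $m$ odd, and put \[ s_k(n-1)=\frac{k^n-n\bigl(|N_0(n,k)|+|N_2(n,k)|\bigr)-m\bigl(|N_1(n,k)|-\delta\bigr)-\delta}{2}. \] Let $X_k(n-1)$ denote any union of $E_k(n-1)$ with the edge sets of exactly one circuit from each pair $\{C,\,-C^R\}$ of non-negasymmetric circuits in $\mathcal C_k(n-1)$, where $-C^R=\{-\mathbf a^R:\mathbf a\in C\}$. Let $D(a_0,\dots,a_n)=(a_1-a_0,\dots,a_n-a_{n-1})$. Then: (a) there exists an $\mathcal{OS}_k(n+1)$ of period $k\,s_k(n-1)$; (b) at least one such set $X_k(n-1)$ exists, and for every such set the subgraph of $B_k(n)$ with edge set $D^{-1}(X_k(n-1))$ has an Eulerian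 circuit whose associated sequence is an $\mathcal{OS}_k(n+1)$ of period $k\,|X_k(n-1)|\ge k\,s_k(n-1)$. -/

import Mathlib

namespace OrientableSeq

/-- `k`-ary `n`-tuples `(u_0, …, u_{n-1})`. They label the vertices of the de Bruijn digraph
`B_k(n)` and the edges of `B_k(n-1)`. -/
abbrev Tuple (k n : ℕ) : Type := Fin n → ZMod k

/-- The reverse `u^R = (u_{n-1}, …, u_0)`. -/
def reverse {k n : ℕ} (u : Tuple k n) : Tuple k n := fun i => u i.rev

/-- The `n`-tuple `(s_i, s_{i+1}, …, s_{i+n-1})` of a sequence. -/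
def window {k : ℕ} (s : ℕ → ZMod k) (n i : ℕ) : Tuple k n := fun j => s (i + j)

/-- `m` is the period of `s`: the least positive integer with `s_{i+m} = s_i` for all `i`. -/
def HasPeriod {k : ℕ} (s : ℕ → ZMod k) (m : ℕ) : Prop :=
  IsLeast {c : ℕ | 0 < c ∧ ∀ i, s (i + c) = s i} m

/-- `s` is a `k`-ary `n`-window sequence of period `m`. -/
structure IsWindowSequence {k : ℕ} (n : ℕ) (s : ℕ → ZMod k) (m : ℕ) : Prop where
  hasPeriod : HasPeriod s m
  window_inj : ∀ i j : ℕ, window s n i = window s n j → i ≡ j [MOD m]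

/-- `s` is an orientable sequence of order `n` over `ZMod k`, of period `m`. -/
structure IsOrientableSequence {k : ℕ} (n : ℕ) (s : ℕ → ZMod k) (m : ℕ) : Prop where
  isWindowSequence : IsWindowSequence n s m
  window_ne_reverse : ∀ i j : ℕ, window s n i ≠ reverse (window s n j)

/-- The pseudoweight: the integer sum of the entries, with every `0` counted as `k/2`. -/
def pseudoweight {k n : ℕ} (u : Tuple k n) : ℚ :=
  ∑ i, if u i = 0 then (k : ℚ) / 2 else ((u i).val : ℚ)

/-- `E_k(n-1)`: the edges (`n`-tuples) of `B_k(n-1)` of pseudoweight less than `kn/2`. -/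
def lowEdges (k n : ℕ) : Set (Tuple k n) := {u | pseudoweight u < (k : ℚ) * n / 2}

/-- `H_k(n-1)`: the edges (`n`-tuples) of `B_k(n-1)` of pseudoweight exactly `kn/2`. -/
def midEdges (k n : ℕ) : Set (Tuple k n) := {u | pseudoweight u = (k : ℚ) * n / 2}

/-- The cyclic shift `(a_c, a_{c+1}, …, a_{c-1})`, indices modulo `n`. -/
def cyclicShift {k n : ℕ} (a : Tuple k n) (c : ℕ) : Tuple k n :=
  fun i => a ((finRotate n ^ c) i)

/-- The circuit `[a_0, …, a_{n-1}]` of `B_k(n-1)`, given by its set of edges. -/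
def circuit {k n : ℕ} (a : Tuple k n) : Set (Tuple k n) := Set.range (cyclicShift a)

/-- `𝒞_k(n-1)`: the circuits `[a_0, …, a_{n-1}]` with `(a_0, …, a_{n-1})` in `H_k(n-1)`. -/
def circuits (k n : ℕ) : Set (Set (Tuple k n)) := circuit '' midEdges k n

/-- A tuple is negasymmetric if `a = -a^R`. -/
def IsNegasymmetric {k n : ℕ} (a : Tuple k n) : Prop := a = -reverse a

/-- A circuit is negasymmetric if it has edges `a`, `b` (possibly equal) with `a = -b^R`. -/
def IsNegasymmetricCircuit {k n : ℕ} (C : Set (Tuple k n)) : Prop :=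
  ∃ a ∈ C, ∃ b ∈ C, a = -reverse b

/-- The reverse-complementary circuit `[-a_{n-1}, …, -a_0]` of `[a_0, …, a_{n-1}]`. -/
def reverseComplement {k n : ℕ} (C : Set (Tuple k n)) : Set (Tuple k n) :=
  (fun a => -reverse a) '' C

/-- The non-negasymmetric circuits in `𝒞_k(n-1)`. -/
def nonNegaCircuits (k n : ℕ) : Set (Set (Tuple k n)) :=
  {C ∈ circuits k n | ¬ IsNegasymmetricCircuit C}

/-- `X` is an admissible choice of `X_k(n-1)`: the union of `E_k(n-1)` and of the edge sets of one
circuit from each reverse-complementary pair of non-negasymmetric circuits in `𝒞_k(n-1)`. -/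
def IsExtension (k n : ℕ) (X : Set (Tuple k n)) : Prop :=
  ∃ S : Set (Set (Tuple k n)), S ⊆ nonNegaCircuits k n ∧
    (∀ C ∈ nonNegaCircuits k n, Xor (C ∈ S) (reverseComplement C ∈ S)) ∧
    X = lowEdges k n ∪ ⋃₀ S

/-- `N_i(n,k)`: the negasymmetric circuits in `𝒞_k(n-1)` with exactly `i` negasymmetric
`n`-tuples. -/
def negaCircuits (i n k : ℕ) : Set (Set (Tuple k n)) :=
  {C ∈ circuits k n | IsNegasymmetricCircuit C ∧ {a ∈ C | IsNegasymmetric a}.ncard = i}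

/-- `δ = 1` if `k` is odd, `δ = 2` if `k` is even. -/
def delta (k : ℕ) : ℕ := if Even k then 2 else 1

/-- The odd part `m` of `n = 2^t m`. -/
def oddPart (n : ℕ) : ℕ := n / 2 ^ padicValNat 2 n

/-- The number `s_k(n-1)`. -/
noncomputable def sBound (k n : ℕ) : ℚ :=
  ((k : ℚ) ^ n
    - n * (((negaCircuits 0 n k).ncard : ℚ) + ((negaCircuits 2 n k).ncard : ℚ))
    - oddPart n * (((negaCircuits 1 n k).ncard : ℚ) - delta k)
    - delta k) / 2

/-- The generalised Lempel homomorphism `D_β`, from `(n+1)`-tuples to `n`-tuples. -/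
def lempelBeta {k n : ℕ} (β : (ZMod k)ˣ) (a : Tuple k (n + 1)) : Tuple k n :=
  fun i => β * (a i.succ - a i.castSucc)

/-- `D = D_1`. -/
def lempel {k n : ℕ} (a : Tuple k (n + 1)) : Tuple k n := lempelBeta 1 a

/-- `e_0, e_1, …, e_{L-1}`, continued with period `L`, is an Eulerian circuit of the subgraph of
`B_k(n)` with edge set `F`. The edge `(a_0, …, a_n)` goes from the vertex `(a_0, …, a_{n-1})`
(`Fin.init`) to the vertex `(a_1, …, a_n)` (`Fin.tail`). -/
structure IsEulerianCircuit {k n : ℕ} (F : Set (Tuple k (n + 1))) (L : ℕ)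
    (e : ℕ → Tuple k (n + 1)) : Prop where
  pos : 0 < L
  periodic : ∀ i, e (i + L) = e i
  linked : ∀ i, Fin.tail (e i) = Fin.init (e (i + 1))
  bijOn : Set.BijOn e (Set.Iio L) F

end OrientableSeq

/-! Since `D(a^R) = -D(a)^R`, an Eulerian circuit of the subgraph with edge set `D⁻¹(Z)` gives an
orientable sequence as soon as `Z` is disjoint from `-Z^R`; its period is the number `k|Z|` of
edges. What remains is to find such `Z` for which `D⁻¹(Z)` is balanced and connected.

An extension `X` is disjoint from `-X^R`, because `a ↦ -a^R` sends pseudoweight `w` to `kn - w` and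
pairs the non-negasymmetric circuits of weight `kn/2`. It is closed under cyclic shifts, which gives
balance. It is closed under replacing an entry by `1`, the unique lightest entry for `k ≥ 3`. Hence
a walk in `D⁻¹(X)` can be continued with difference `1` until it reaches a ramp `(x, x+1, …)`, and
the all-ones tuple links consecutive ramps. This gives connectedness, and part (b) up to the size
estimate.

The `k^n` tuples split into `X`, `-X^R` and the tuples on negasymmetric circuits. The latter
circuits have one negasymmetric tuple if their length is odd, none or two if it is even. Thus
`s_k(n-1)` is what `|X|` would be if the `δ` constant negasymmetric circuits had length `1`, the
other odd ones length `m` and the even ones length `n`. True lengths are never larger, so `|X| =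
s_k(n-1) + t` with `t ≥ 0` (`IsExtension.exists_eq_sBound_add`).

Part (a) asks for the period `k s_k(n-1)` exactly, so `t` edges have to be removed from `X`.
Deleting whole circuits keeps both closure properties if the circuits are chosen well, and brings
the size within `n` of the target (`exists_isUnitClosed_between`). The remaining `r < n` edges are
the all-ones loop if `r = 1`, or the windows of the sequence of period `0, 1, …, 1` of length `r ≥
2`; neither removal destroys balance or connectedness (`exists_connected_subset`). A small core of
tuples is protected throughout, and crude estimates show that `t` is small enough to leave room for
it. -/

namespace OrientableSeq

/-! ### Eulerian circuits of finite digraphs -/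

section Euler

theorem iterate_eq_iterate_iff_modEq {α : Type*} {f : α → α} {x : α}
    (hx : x ∈ Function.periodicPts f) (i j : ℕ) :
    f^[i] x = f^[j] x ↔ i ≡ j [MOD Function.minimalPeriod f x] := by
  have hpos := Function.minimalPeriod_pos_of_mem_periodicPts hx
  rw [← Function.iterate_mod_minimalPeriod_eq (n := i),
    ← Function.iterate_mod_minimalPeriod_eq (n := j),
    Function.iterate_eq_iterate_iff_of_lt_minimalPeriod (Nat.mod_lt _ hpos) (Nat.mod_lt _ hpos)]
  rfl

theorem range_iterate_eq_image {α : Type*} {f : α → α} {x : α}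
    (hx : x ∈ Function.periodicPts f) :
    Set.range (fun i => f^[i] x) = (fun i => f^[i] x) '' Set.Iio (Function.minimalPeriod f x) := by
  have hpos := Function.minimalPeriod_pos_of_mem_periodicPts hx
  refine Set.Subset.antisymm ?_ (Set.image_subset_range _ _)
  rintro _ ⟨i, rfl⟩
  exact ⟨_, Nat.mod_lt i hpos, Function.iterate_mod_minimalPeriod_eq⟩

theorem ncard_range_iterate {α : Type*} {f : α → α} {x : α}
    (hx : x ∈ Function.periodicPts f) :
    (Set.range (fun i => f^[i] x)).ncard = Function.minimalPeriod f x := by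
  rw [range_iterate_eq_image hx, Function.iterate_injOn_Iio_minimalPeriod.ncard_image,
    ← Finset.coe_Iio, Set.ncard_coe_finset, Nat.card_Iio]

variable {F V : Type*}

/-- Composition with the swap sends `c` to `σ b`, and from there the old cycle of `b` is followed
unchanged until it returns to `b`. Two distinct cycles are thereby merged. -/
theorem sameCycle_mul_swap [Finite F] [DecidableEq F] {σ : Equiv.Perm F} {b c x : F}
    (h : ¬ σ.SameCycle b c) (hx : σ.SameCycle b x) : (σ * Equiv.swap b c).SameCycle c x := by
  have key : ∀ i : ℕ, (σ * Equiv.swap b c).SameCycle c ((σ ^ (i + 1)) b) := by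
    intro i
    induction i with
    | zero => exact ⟨1, by simp⟩
    | succ i ih =>
      by_cases hb : (σ ^ (i + 1)) b = b
      · rw [pow_succ' σ (i + 1), Equiv.Perm.mul_apply, hb]
        exact ⟨1, by simp⟩
      · have hc : (σ ^ (i + 1)) b ≠ c := fun hc => h ⟨((i + 1 : ℕ) : ℤ), by
          rw [zpow_natCast]; exact hc⟩
        have := Equiv.Perm.sameCycle_apply_right.2 ih
        rwa [Equiv.Perm.mul_apply, Equiv.swap_apply_of_ne_of_ne hb hc, ← Equiv.Perm.mul_apply,
          ← pow_succ'] at this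
  have := Fintype.ofFinite F
  obtain ⟨i, hi, -, rfl⟩ := hx.exists_pow_eq''
  obtain ⟨i, rfl⟩ := Nat.exists_eq_succ_of_ne_zero hi.ne'
  exact key i

/-- A balanced connected finite digraph, with edges `F`, sources `h` and targets `t`, has a
successor permutation consisting of a single cycle. -/
theorem exists_successor_sameCycle [Finite F] (t h : F → V)
    (bal : ∀ v, Nat.card {b // t b = v} = Nat.card {b // h b = v})
    (conn : ∀ A : Set F, A.Nonempty → (∀ b ∈ A, ∀ c, (h c = h b ∨ h c = t b ∨ t c = h b ∨ t c = t b) →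
      c ∈ A) →
      A = Set.univ) :
    ∃ σ : Equiv.Perm F, (∀ b, h (σ b) = t b) ∧ ∀ b c, σ.SameCycle b c := by
  classical
  rcases isEmpty_or_nonempty F with hF | ⟨⟨e⟩⟩
  · exact ⟨1, fun b => isEmptyElim b, fun b => isEmptyElim b⟩
  have hs : {σ : Equiv.Perm F | ∀ b, h (σ b) = t b}.Nonempty :=
    ⟨Equiv.ofFiberEquiv (f := t) (g := h) fun v => (Finite.card_eq.1 (bal v)).some,
      fun b => Equiv.ofFiberEquiv_map _ b⟩
  -- Balance provides some successor permutation; one with the longest cycle through `e` is chosen.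
  obtain ⟨σ, hσ, hmax⟩ := Set.exists_max_image _
    (fun σ : Equiv.Perm F => {x | σ.SameCycle e x}.ncard) (Set.toFinite _) hs
  simp only [Set.mem_ofPred_eq] at hσ hmax
  have huniv : {x | σ.SameCycle e x} = Set.univ := by
    apply conn _ ⟨e, Equiv.Perm.SameCycle.refl _ _⟩
    -- If `c` lay outside the cycle, `σ * swap b c` would still be a successor permutation because
    -- `t b = t c`, and its cycle through `e` would be longer.
    have main : ∀ b c, σ.SameCycle e b → t b = t c → σ.SameCycle e c := by
      intro b c hb hbc
      by_contra hc
      have hn : ¬ σ.SameCycle b c := fun hn => hc (hb.trans hn)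
      have h1 := hmax (σ * Equiv.swap b c) (by
        intro x
        rw [Equiv.Perm.mul_apply, hσ]
        rcases eq_or_ne x b with rfl | hxb
        · simp [hbc]
        rcases eq_or_ne x c with rfl | hxc
        · simp [hbc]
        rw [Equiv.swap_apply_of_ne_of_ne hxb hxc])
      have h2 : {x | σ.SameCycle e x} ⊂ {x | (σ * Equiv.swap b c).SameCycle e x} := by
        have he := sameCycle_mul_swap hn hb.symm
        refine (Set.ssubset_iff_of_subset fun x hx => ?_).2 ⟨c, he.symm, hc⟩
        exact he.symm.trans (sameCycle_mul_swap hn (hb.symm.trans hx))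
      exact absurd (Set.ncard_lt_ncard h2 (Set.toFinite _)) (not_lt.2 h1)
    rintro b hb c (hc | hc | hc | hc)
    · have hb' : σ.SameCycle e (σ.symm b) := Equiv.Perm.sameCycle_symm_apply_right.2 hb
      have hc' : t (σ.symm b) = t (σ.symm c) := by simp [← hσ, hc]
      exact Equiv.Perm.sameCycle_symm_apply_right.1 (main _ _ hb' hc')
    · have hc' : t b = t (σ.symm c) := by simp [← hσ, hc]
      exact Equiv.Perm.sameCycle_symm_apply_right.1 (main _ _ hb hc')
    · have hb' : σ.SameCycle e (σ.symm b) := Equiv.Perm.sameCycle_symm_apply_right.2 hb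
      have hc' : t (σ.symm b) = t c := by rw [← hσ, Equiv.apply_symm_apply, hc]
      exact main _ _ hb' hc'
    · exact main _ _ hb hc.symm
  have hall : ∀ x, σ.SameCycle e x := fun x => by
    have : x ∈ {x | σ.SameCycle e x} := by rw [huniv]; trivial
    exact this
  exact ⟨σ, hσ, fun b c => (hall b).symm.trans (hall c)⟩

end Euler

/-! ### From Eulerian circuits of `D⁻¹(Z)` to orientable sequences -/

variable {k n : ℕ}

theorem lempel_apply (a : Tuple k (n + 1)) (i : Fin n) :
    lempel a i = a i.succ - a i.castSucc := by
  simp [lempel, lempelBeta]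

/-- A tuple is determined by its first entry and its differences, and both are arbitrary. -/
theorem ncard_lempel_preimage [NeZero k] (Z : Set (Tuple k n)) :
    (lempel ⁻¹' Z : Set (Tuple k (n + 1))).ncard = k * Z.ncard := by
  have h : Function.Bijective (fun b : Tuple k (n + 1) => (b 0, lempel b)) := by
    rw [Fintype.bijective_iff_injective_and_card]
    constructor
    · intro a b hab
      simp only [Prod.mk.injEq] at hab
      funext i
      induction i using Fin.induction with
      | zero => exact hab.1
      | succ i ih =>
        have := congrFun hab.2 i
        rw [lempel_apply, lempel_apply, ih] at this
        exact sub_left_injective this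
    · simp [ZMod.card, pow_succ, mul_comm]
  have h2 : (lempel ⁻¹' Z : Set (Tuple k (n + 1)))
      = (fun b : Tuple k (n + 1) => (b 0, lempel b)) ⁻¹' (Set.univ ×ˢ Z) := by
    ext; simp
  rw [h2, Set.ncard_preimage_of_injective_subset_range h.1 (by simp [h.2.range_eq]),
    Set.ncard_prod, Set.ncard_univ, Nat.card_zmod]

theorem window_succ_tail (s : ℕ → ZMod k) (n i : ℕ) :
    Fin.tail (window s (n + 1) i) = window s n (i + 1) := by
  funext j; simp [Fin.tail, window, add_left_comm, add_comm]

theorem window_succ_init (s : ℕ → ZMod k) (n i : ℕ) :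
    Fin.init (window s (n + 1) i) = window s n i := by
  funext j; simp [Fin.init, window]

theorem window_of_linked (e : ℕ → Tuple k (n + 1))
    (he : ∀ i, Fin.tail (e i) = Fin.init (e (i + 1))) :
    window (fun i => e i 0) (n + 1) = e := by
  have key : ∀ (j : ℕ) (hj : j < n + 1) (i : ℕ), e (i + j) 0 = e i ⟨j, hj⟩ := by
    intro j
    induction j with
    | zero => intro _ _; rfl
    | succ j ih =>
      intro hj i
      have := congrFun (he i) ⟨j, by omega⟩
      rw [show i + (j + 1) = i + 1 + j by ring, ih (by omega)]
      exact this.symm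
  funext i j
  exact key j j.2 i

/-- This identity turns orientability of the lifted sequence into the condition `a ≠ -b^R` on the
edges of `Z`. -/
theorem lempel_reverse (a : Tuple k (n + 1)) : lempel (reverse a) = -reverse (lempel a) := by
  funext i
  simp [lempel_apply, reverse, Fin.rev_succ, Fin.rev_castSucc]

/-- Adjacency of two vertices of the subgraph of `B_k(n)` with edge set `D⁻¹(Z)`. -/
def LiftAdj (Z : Set (Tuple k n)) (v w : Tuple k n) : Prop :=
  ∃ b : Tuple k (n + 1), lempel b ∈ Z ∧ Fin.init b = v ∧ Fin.tail b = w

/-- Weak connectedness in the subgraph of `B_k(n)` with edge set `D⁻¹(Z)`. -/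
def LiftLinked (Z : Set (Tuple k n)) : Tuple k n → Tuple k n → Prop :=
  Relation.EqvGen (LiftAdj Z)

/-- The subgraph of `B_k(n)` with edge set `D⁻¹(Z)` is balanced. -/
def LiftBalanced (Z : Set (Tuple k n)) : Prop :=
  ∀ v : Tuple k n, {b : Tuple k (n + 1) | lempel b ∈ Z ∧ Fin.tail b = v}.ncard =
    {b : Tuple k (n + 1) | lempel b ∈ Z ∧ Fin.init b = v}.ncard

/-- The sequence consists of the first entries along an Eulerian circuit. Its windows of length `n +
1` are the edges, each met once per period, so the number of edges is the least period. -/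
theorem exists_eulerian_orientable [NeZero k] {Z : Set (Tuple k n)} (hne : Z.Nonempty)
    (hbal : LiftBalanced Z)
    (hconn : ∀ b c : Tuple k (n + 1), lempel b ∈ Z → lempel c ∈ Z →
      LiftLinked Z (Fin.init b) (Fin.init c))
    (hanti : ∀ a ∈ Z, ∀ b ∈ Z, a ≠ -reverse b) :
    ∃ s : ℕ → ZMod k, IsEulerianCircuit (lempel ⁻¹' Z) (k * Z.ncard) (window s (n + 1)) ∧
      IsOrientableSequence (n + 1) s (k * Z.ncard) := by
  classical
  let F := (lempel ⁻¹' Z : Set (Tuple k (n + 1)))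
  have hcardF : Nat.card F = k * Z.ncard := ncard_lempel_preimage Z
  have hpos : 0 < k * Z.ncard :=
    Nat.mul_pos (NeZero.pos k) ((Set.ncard_pos (Set.toFinite _)).2 hne)
  obtain ⟨σ, hσ, hcyc⟩ := exists_successor_sameCycle (F := F) (V := Tuple k n)
    (fun b => Fin.tail b.1) (fun b => Fin.init b.1)
    (by
      intro v
      have h1 : ∀ f : Tuple k (n + 1) → Tuple k n,
          Nat.card {b : F // f b.1 = v} = {b | lempel b ∈ Z ∧ f b = v}.ncard := by
        intro f
        exact Nat.card_congr (Equiv.subtypeSubtypeEquivSubtypeInter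
          (fun b => lempel b ∈ Z) (fun b => f b = v))
      rw [h1 Fin.tail, h1 Fin.init]; exact hbal v)
    (by
      rintro A ⟨b₀, hb₀⟩ hA
      let W : Set (Tuple k n) := {v | ∃ b ∈ A, Fin.init b.1 = v ∨ Fin.tail b.1 = v}
      have hW : ∀ c : F, Fin.init c.1 ∈ W → c ∈ A := by
        rintro c ⟨b, hb, h | h⟩
        · exact hA b hb c (Or.inl h.symm)
        · exact hA b hb c (Or.inr (Or.inl h.symm))
      have hclosed : ∀ c : F, Fin.tail c.1 ∈ W → c ∈ A := by
        rintro c ⟨b, hb, h | h⟩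
        · exact hA b hb c (Or.inr (Or.inr (Or.inl h.symm)))
        · exact hA b hb c (Or.inr (Or.inr (Or.inr h.symm)))
      have hlink : ∀ v w, LiftLinked Z v w → (v ∈ W ↔ w ∈ W) := by
        intro v w h
        induction h with
        | rel v w h =>
          obtain ⟨b, hb, rfl, rfl⟩ := h
          exact ⟨fun h => ⟨⟨b, hb⟩, hW ⟨b, hb⟩ h, Or.inr rfl⟩,
            fun h => ⟨⟨b, hb⟩, hclosed ⟨b, hb⟩ h, Or.inl rfl⟩⟩
        | refl => rfl
        | symm _ _ _ ih => exact ih.symm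
        | trans _ _ _ _ _ ih1 ih2 => exact ih1.trans ih2
      refine Set.eq_univ_of_forall fun c => hW c ?_
      exact (hlink _ _ (hconn b₀.1 c.1 b₀.2 c.2)).1 ⟨b₀, hb₀, Or.inl rfl⟩)
  obtain ⟨b₀⟩ : Nonempty F := (Nat.card_pos_iff.1 (hcardF ▸ hpos)).1
  set p := k * Z.ncard with hp
  have hordp : ∀ i j : ℕ, (σ ^ i) b₀ = (σ ^ j) b₀ ↔ i ≡ j [MOD p] := by
    intro i j
    have hper : b₀ ∈ Function.periodicPts σ :=
      Function.Injective.mem_periodicPts σ.injective b₀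
    have hrange : Set.range (fun i => σ^[i] b₀) = Set.univ := by
      have := Fintype.ofFinite F
      refine Set.eq_univ_of_forall fun b => ?_
      obtain ⟨i, -, -, hi⟩ := (hcyc b₀ b).exists_pow_eq''
      exact ⟨i, by simp only [← hi, Equiv.Perm.iterate_eq_pow]⟩
    have hmin := ncard_range_iterate hper
    rw [hrange, Set.ncard_univ, hcardF] at hmin
    rw [hmin, ← iterate_eq_iterate_iff_modEq hper, Equiv.Perm.iterate_eq_pow,
      Equiv.Perm.iterate_eq_pow]
  let e : ℕ → Tuple k (n + 1) := fun i => ((σ ^ i) b₀ : F).1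
  have hlinked : ∀ i, Fin.tail (e i) = Fin.init (e (i + 1)) := by
    intro i
    have := hσ ((σ ^ i) b₀)
    rw [← Equiv.Perm.mul_apply, ← pow_succ'] at this
    exact this.symm
  have hwin := window_of_linked e hlinked
  have hee : ∀ i j, e i = e j ↔ i ≡ j [MOD p] := fun i j => by
    rw [← hordp]; exact Subtype.ext_iff.symm
  refine ⟨fun i => e i 0, ⟨hpos, ?_, ?_, ?_⟩, ⟨⟨⟨⟨hpos, ?_⟩, ?_⟩, ?_⟩, ?_⟩⟩
  · intro i
    rw [hwin, hee]; simp [Nat.ModEq]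
  · rw [hwin]; exact hlinked
  · rw [hwin]
    refine ⟨fun i _ => ((σ ^ i) b₀).2, fun i hi j hj hij => ?_, fun b hb => ?_⟩
    · exact Nat.ModEq.eq_of_lt_of_lt ((hee i j).1 hij) hi hj
    · have := Fintype.ofFinite F
      obtain ⟨i, -, -, hi⟩ := (hcyc b₀ ⟨b, hb⟩).exists_pow_eq''
      refine ⟨i % p, Nat.mod_lt _ hpos, ?_⟩
      rw [(hee (i % p) i).2 (Nat.mod_modEq i p)]
      exact congrArg Subtype.val hi
  · intro i
    have : e (i + p) = e i := (hee _ _).2 (by simp [Nat.ModEq])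
    exact congrFun this 0
  · rintro c ⟨hc, hper⟩
    have : e (0 + c) = e 0 := by
      rw [← hwin]
      funext j
      have := hper (0 + j)
      simp only [window] at this ⊢
      rw [← this, show 0 + c + (j : ℕ) = 0 + j + c by ring]
    have := (hee _ _).1 this
    rw [zero_add] at this
    exact Nat.le_of_dvd hc ((Nat.modEq_zero_iff_dvd).1 this)
  · intro i j hij
    rw [hwin] at hij
    exact (hee i j).1 hij
  · intro i j hij
    rw [hwin] at hij
    have h1 := ((σ ^ i) b₀).2
    have h2 := ((σ ^ j) b₀).2
    refine hanti _ h1 _ h2 ?_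
    change lempel (e i) = -reverse (lempel (e j))
    rw [← lempel_reverse, hij]

/-! ### Cyclic shifts of tuples -/

theorem finRotate_pow_apply (c : ℕ) (i : Fin n) :
    (finRotate n ^ c) i = ⟨(i + c) % n, Nat.mod_lt _ i.pos⟩ := by
  induction c with
  | zero => ext; simp [Nat.mod_eq_of_lt i.2]
  | succ c ih =>
    rw [pow_succ', Equiv.Perm.mul_apply, ih]
    obtain ⟨m, rfl⟩ := Nat.exists_eq_succ_of_ne_zero i.pos.ne'
    ext
    rw [finRotate_apply, Fin.val_add]
    simp [← add_assoc]

theorem cyclicShift_apply (a : Tuple k n) (c : ℕ) (i : Fin n) :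
    cyclicShift a c i = a ⟨(i + c) % n, Nat.mod_lt _ i.pos⟩ := by
  rw [cyclicShift, finRotate_pow_apply]

theorem cyclicShift_cyclicShift (a : Tuple k n) (c d : ℕ) :
    cyclicShift (cyclicShift a c) d = cyclicShift a (c + d) := by
  funext i
  simp [cyclicShift, pow_add]

@[simp] theorem cyclicShift_zero (a : Tuple k n) : cyclicShift a 0 = a := by
  funext i; simp [cyclicShift]

@[simp] theorem cyclicShift_self (a : Tuple k n) : cyclicShift a n = a := by
  funext i; simp [cyclicShift_apply, Nat.mod_eq_of_lt i.2]

theorem cyclicShift_mul_self (a : Tuple k n) (c : ℕ) : cyclicShift a (c * n) = a := by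
  funext i; simp [cyclicShift_apply, Nat.mod_eq_of_lt i.2]

/-! ### Balance of the lifted subgraph -/

section Balance

/-- If `A` is permuted by an operation that drops the first entry of a tuple and appends an
entry, then `D⁻¹(A)` is balanced. -/
theorem liftBalanced_of_next [NeZero k] {A : Set (Tuple k (n + 1))} (g : Tuple k (n + 1) → ZMod k)
    (hmem : ∀ c ∈ A, (Fin.snoc (Fin.tail c) (g c) : Tuple k (n + 1)) ∈ A)
    (hinj : ∀ c ∈ A, ∀ c' ∈ A, Fin.tail c = Fin.tail c' → g c = g c' → c 0 = c' 0) :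
    LiftBalanced A := by
  -- The operation on differences lifts to edges, and takes an edge entering `v` to an edge leaving
  -- `v`. It is injective on a finite set, hence bijective, so the in-degree of `v` equals its
  -- out-degree.
  let σ : Tuple k (n + 2) → Tuple k (n + 2) :=
    fun b => Fin.snoc (Fin.tail b) (b (Fin.last _) + g (lempel b))
  have hσ : ∀ b, lempel (σ b) = Fin.snoc (Fin.tail (lempel b)) (g (lempel b)) := by
    intro b
    funext i
    refine Fin.lastCases ?_ (fun i => ?_) i
    · simp [lempel_apply, σ, Fin.tail]
    · have h : (i.castSucc.succ : Fin (n + 2)) = i.succ.castSucc := Fin.succ_castSucc i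
      simp only [lempel_apply, σ, Fin.snoc_castSucc, h, Fin.tail]
  let F : Set (Tuple k (n + 2)) := {b | lempel b ∈ A}
  have hF : Set.MapsTo σ F F := fun b hb => by
    change lempel (σ b) ∈ A
    rw [hσ]; exact hmem _ hb
  have hσi : Set.InjOn σ F := by
    intro b hb b' hb' h
    have h0 : Fin.tail b = Fin.tail b' := by
      have := congrArg Fin.init h
      simpa [σ] using this
    have hs : ∀ i : Fin (n + 1), b i.succ = b' i.succ := fun i => congrFun h0 i
    have h1 : Fin.tail (lempel b) = Fin.tail (lempel b') := by
      funext i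
      simp only [Fin.tail, lempel_apply]
      rw [← Fin.succ_castSucc, hs, hs]
    have h2 : g (lempel b) = g (lempel b') := by
      have := congrFun h (Fin.last _)
      simp only [σ, Fin.snoc_last] at this
      rw [← Fin.succ_last, hs] at this
      exact add_left_cancel this
    have h3 := hinj _ hb _ hb' h1 h2
    funext i
    refine Fin.cases ?_ hs i
    rw [lempel_apply, lempel_apply, hs] at h3
    exact sub_right_injective h3
  have hsurj : Set.SurjOn σ F F :=
    (((Set.toFinite F).injOn_iff_bijOn_of_mapsTo hF).1 hσi).surjOn
  intro v
  rw [← (hσi.mono (s₁ := {b | lempel b ∈ A ∧ Fin.tail b = v}) (fun b hb => hb.1)).ncard_image]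
  congr 1
  ext b
  constructor
  · rintro ⟨b, hb, rfl⟩
    exact ⟨hF hb.1, by simp [σ, hb.2]⟩
  · rintro ⟨hb, hv⟩
    obtain ⟨b, hb', rfl⟩ := hsurj hb
    exact ⟨b, ⟨hb', by simpa [σ] using hv⟩, rfl⟩

theorem LiftBalanced.diff [NeZero k] {A B : Set (Tuple k n)} (hB : LiftBalanced B)
    (hA : LiftBalanced A) (hAB : A ⊆ B) : LiftBalanced (B \ A) := by
  intro v
  have h : ∀ f : Tuple k (n + 1) → Tuple k n,
      {b : Tuple k (n + 1) | lempel b ∈ B \ A ∧ f b = v}.ncard =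
      {b : Tuple k (n + 1) | lempel b ∈ B ∧ f b = v}.ncard -
      {b : Tuple k (n + 1) | lempel b ∈ A ∧ f b = v}.ncard := by
    intro f
    rw [← Set.ncard_sdiff (s := {b | lempel b ∈ A ∧ f b = v}) (t := {b | lempel b ∈ B ∧ f b = v})
      (fun b hb => ⟨hAB hb.1, hb.2⟩) (Set.toFinite _)]
    congr 1
    ext b
    simp only [Set.mem_sdiff, Set.mem_ofPred_eq]
    tauto
  rw [h, h, hA, hB]

end Balance

/-! ### Walks to the ramps -/

section Walks

/-- The differences of consecutive terms of `s` are the terms of `d`. -/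
def IsLiftOf (s d : ℕ → ZMod k) : Prop := ∀ l, s (l + 1) = s l + d l

theorem IsLiftOf.lempel_window {s d : ℕ → ZMod k} (h : IsLiftOf s d) (l : ℕ) :
    lempel (window s (n + 1) l) = window d n l := by
  funext i
  simp [lempel_apply, window, ← add_assoc, h (l + i)]

theorem IsLiftOf.eq_add_sum {s d : ℕ → ZMod k} (h : IsLiftOf s d) (l : ℕ) :
    s l = s 0 + ∑ i ∈ Finset.range l, d i := by
  induction l with
  | zero => simp
  | succ l ih => rw [h, ih, Finset.sum_range_succ, add_assoc]

theorem exists_isLiftOf (d : ℕ → ZMod k) (x : ZMod k) (l : ℕ) :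
    ∃ s, IsLiftOf s d ∧ s l = x := by
  refine ⟨fun j => x - ∑ i ∈ Finset.range l, d i + ∑ i ∈ Finset.range j, d i, fun j => ?_, ?_⟩
  · simp [Finset.sum_range_succ, add_assoc]
  · simp

theorem exists_isLiftOf_window {b : Tuple k (n + 1)} {d : ℕ → ZMod k} {l : ℕ}
    (h : lempel b = window d n l) : ∃ s, IsLiftOf s d ∧ window s (n + 1) l = b := by
  obtain ⟨s, hs, h0⟩ := exists_isLiftOf d (b 0) l
  refine ⟨s, hs, ?_⟩
  funext i
  induction i using Fin.induction with
  | zero => simpa [window] using h0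
  | succ i ih =>
    have h1 := congrFun h i
    rw [lempel_apply, sub_eq_iff_eq_add] at h1
    rw [h1, ← ih]
    simp [window, ← add_assoc, hs (l + i), add_comm]

theorem LiftLinked.symm {Z : Set (Tuple k n)} {v w : Tuple k n} (h : LiftLinked Z v w) :
    LiftLinked Z w v := Relation.EqvGen.symm _ _ h

theorem LiftLinked.trans {Z : Set (Tuple k n)} {u v w : Tuple k n} (h : LiftLinked Z u v)
    (h' : LiftLinked Z v w) : LiftLinked Z u w := Relation.EqvGen.trans _ _ _ h h'

theorem LiftLinked.refl (Z : Set (Tuple k n)) (v : Tuple k n) :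
    LiftLinked Z v v := Relation.EqvGen.refl _

theorem LiftLinked.of_edge {Z : Set (Tuple k n)} {b : Tuple k (n + 1)} (hb : lempel b ∈ Z) :
    LiftLinked Z (Fin.init b) (Fin.tail b) := Relation.EqvGen.rel _ _ ⟨b, hb, rfl, rfl⟩

theorem IsLiftOf.liftLinked {s d : ℕ → ZMod k} (h : IsLiftOf s d) {Z : Set (Tuple k n)}
    {i j : ℕ} (hij : i ≤ j) (hd : ∀ l, i ≤ l → l < j → window d n l ∈ Z) :
    LiftLinked Z (window s n i) (window s n j) := by
  induction j, hij using Nat.le_induction with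
  | base => exact LiftLinked.refl _ _
  | succ j hij ih =>
    refine (ih fun l hl hl' => hd l hl (hl'.trans j.lt_succ_self)).trans ?_
    rw [← window_succ_init, ← window_succ_tail]
    exact LiftLinked.of_edge (by rw [h.lempel_window]; exact hd j hij j.lt_succ_self)

/-- The vertex `(x, x + 1, …, x + n - 1)`. -/
def ramp (k n : ℕ) (x : ZMod k) : Tuple k n := fun i => x + (i : ℕ)

theorem IsLiftOf.window_eq_ramp {s d : ℕ → ZMod k} (h : IsLiftOf s d) {l : ℕ}
    (hd : ∀ i, i + 1 < n → d (l + i) = 1) : window s n l = ramp k n (s l) := by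
  have key : ∀ i, i < n → s (l + i) = s l + (i : ℕ) := by
    intro i
    induction i with
    | zero => simp
    | succ i ih =>
      intro hi
      rw [← add_assoc, h, ih (by omega), hd i hi]
      push_cast; ring
  funext i
  exact key i i.2

/-- The tuple `a`, followed by ones. -/
def thenOnes (a : Tuple k n) : ℕ → ZMod k := fun l => if h : l < n then a ⟨l, h⟩ else 1

/-- `n - 1` ones followed by the tuple `a`. -/
def onesThen (a : Tuple k n) : ℕ → ZMod k :=
  fun l => if h : n - 1 ≤ l ∧ l - (n - 1) < n then a ⟨l - (n - 1), h.2⟩ else 1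

theorem window_thenOnes_zero (a : Tuple k n) : window (thenOnes a) n 0 = a := by
  funext i; simp [window, thenOnes]

theorem window_onesThen (a : Tuple k n) : window (onesThen a) n (n - 1) = a := by
  funext i
  simp [window, onesThen]

/-- After `n` steps the differences of `b` have left the window, and the current vertex has only
differences `1`. -/
theorem linked_ramp_of_thenOnes {Z : Set (Tuple k n)} {b : Tuple k (n + 1)}
    (h : ∀ l < n, window (thenOnes (lempel b)) n l ∈ Z) :
    ∃ x, LiftLinked Z (Fin.init b) (ramp k n x) := by
  obtain ⟨s, hs, hb⟩ := exists_isLiftOf_window (window_thenOnes_zero (lempel b)).symm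
  refine ⟨s n, ?_⟩
  rw [← hb, window_succ_init, ← hs.window_eq_ramp (n := n)]
  · exact hs.liftLinked (Nat.zero_le _) fun l _ hl => h l hl
  · intro i _; simp [thenOnes]

theorem linked_ramp_of_onesThen [NeZero n] {Z : Set (Tuple k n)} {b : Tuple k (n + 1)}
    (h : ∀ l < n, window (onesThen (lempel b)) n l ∈ Z) :
    ∃ x, LiftLinked Z (Fin.tail b) (ramp k n x) := by
  obtain ⟨s, hs, hb⟩ := exists_isLiftOf_window (window_onesThen (lempel b)).symm
  have hn := NeZero.pos n
  refine ⟨s 0, ?_⟩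
  rw [← hb, window_succ_tail, ← hs.window_eq_ramp (n := n), Nat.sub_add_cancel hn]
  · exact (hs.liftLinked (Nat.zero_le _) fun l _ hl => h l hl).symm
  · intro i hi
    rw [onesThen, dif_neg]; omega

/-- The ramps serve as hubs: they are linked cyclically through `x ↦ x + 1`, which exhausts `ZMod
k`. -/
theorem liftConnected_of_linked_ramp [NeZero k] {Z : Set (Tuple k n)}
    (hb : ∀ b : Tuple k (n + 1), lempel b ∈ Z → ∃ x, LiftLinked Z (Fin.init b) (ramp k n x))
    (hr : ∀ x, LiftLinked Z (ramp k n x) (ramp k n (x + 1))) (b c : Tuple k (n + 1))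
    (hbZ : lempel b ∈ Z) (hcZ : lempel c ∈ Z) : LiftLinked Z (Fin.init b) (Fin.init c) := by
  have hall : ∀ x : ZMod k, LiftLinked Z (ramp k n 0) (ramp k n x) := by
    intro x
    rw [← ZMod.natCast_zmod_val x]
    induction x.val with
    | zero => rw [Nat.cast_zero]; exact LiftLinked.refl _ _
    | succ m ih => rw [Nat.cast_succ]; exact ih.trans (hr _)
  obtain ⟨x, hx⟩ := hb b hbZ
  obtain ⟨y, hy⟩ := hb c hcZ
  exact hx.trans ((hall x).symm.trans ((hall y).trans hy.symm))

theorem linked_ramp_succ_of_one_mem {Z : Set (Tuple k n)} (h : (1 : Tuple k n) ∈ Z) (x : ZMod k) :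
    LiftLinked Z (ramp k n x) (ramp k n (x + 1)) := by
  obtain ⟨s, hs, h0⟩ := exists_isLiftOf (1 : ℕ → ZMod k) x 0
  have := hs.liftLinked (Z := Z) (Nat.zero_le 1) fun l _ _ => h
  rw [hs.window_eq_ramp (fun _ _ => rfl), hs.window_eq_ramp (fun _ _ => rfl), hs 0, h0] at this
  exact this

end Walks

/-- Closure under cyclic shifts and under replacing an entry by `1`. -/
structure IsUnitClosed (Y : Set (Tuple k n)) : Prop where
  shift : ∀ a ∈ Y, ∀ c, cyclicShift a c ∈ Y
  update : ∀ a ∈ Y, ∀ i, Function.update a i 1 ∈ Y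

/-! ### Balance and connectedness for unit-closed sets -/

namespace IsUnitClosed

variable {Y : Set (Tuple k n)}

theorem one_mem (hY : IsUnitClosed Y) (hne : Y.Nonempty) : (1 : Tuple k n) ∈ Y := by
  obtain ⟨a, ha⟩ := hne
  have key : ∀ s : Finset (Fin n), s.piecewise (1 : Tuple k n) a ∈ Y := by
    intro s
    induction s using Finset.induction_on with
    | empty => simpa using ha
    | insert i s _ ih =>
      rw [Finset.piecewise_insert]; exact hY.update _ ih _
  simpa using key Finset.univ

/-- Moving on by one place with a new entry `1` amounts to replacing the outgoing entry by `1` and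
rotating. -/
theorem window_succ_mem (hY : IsUnitClosed Y) {d : ℕ → ZMod k} {l : ℕ} (h : window d n l ∈ Y)
    (hd : d (l + n) = 1) : window d n (l + 1) ∈ Y := by
  rcases Nat.eq_zero_or_pos n with rfl | hn
  · convert h
  have : window d n (l + 1) = cyclicShift (Function.update (window d n l) ⟨0, hn⟩ 1) 1 := by
    funext i
    rw [cyclicShift_apply, Function.update_apply]
    rcases (Nat.succ_le_of_lt i.2).eq_or_lt with hi | hi
    · have : (i + 1 : ℕ) % n = 0 := by rw [← Nat.succ_eq_add_one, hi, Nat.mod_self]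
      rw [if_pos (Fin.ext this), ← hd]
      simp only [window]; congr 1; omega
    · have : (i + 1 : ℕ) % n = i + 1 := Nat.mod_eq_of_lt hi
      rw [if_neg (fun h => by simp [Fin.ext_iff, this] at h)]
      simp only [window, this]; congr 1; omega
  rw [this]
  exact hY.shift _ (hY.update _ h _) _

theorem window_mem_of_succ (hY : IsUnitClosed Y) {d : ℕ → ZMod k} {l : ℕ}
    (h : window d n (l + 1) ∈ Y) (hd : d l = 1) : window d n l ∈ Y := by
  rcases Nat.eq_zero_or_pos n with rfl | hn
  · convert h
  have : window d n l = Function.update (cyclicShift (window d n (l + 1)) (n - 1)) ⟨0, hn⟩ 1 := by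
    funext i
    rw [Function.update_apply, cyclicShift_apply]
    split_ifs with hi
    · subst hi; simpa [window] using hd
    · have hi' : (i : ℕ) ≠ 0 := fun h => hi (Fin.ext h)
      have : (i + (n - 1) : ℕ) % n = i - 1 := by
        rw [show (i + (n - 1) : ℕ) = i - 1 + n by omega, Nat.add_mod_right,
          Nat.mod_eq_of_lt (by omega)]
      simp only [window, this]; congr 1; omega
  rw [this]
  exact hY.update _ (hY.shift _ h _) _

theorem window_thenOnes_mem (hY : IsUnitClosed Y) {a : Tuple k n} (ha : a ∈ Y) (l : ℕ) :
    window (thenOnes a) n l ∈ Y := by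
  induction l with
  | zero => rwa [window_thenOnes_zero]
  | succ l ih => exact hY.window_succ_mem ih (by simp [thenOnes])

theorem window_onesThen_mem (hY : IsUnitClosed Y) {a : Tuple k n} (ha : a ∈ Y) {l : ℕ}
    (hl : l < n) : window (onesThen a) n l ∈ Y := by
  have key : ∀ i, i ≤ n - 1 → window (onesThen a) n (n - 1 - i) ∈ Y := by
    intro i
    induction i with
    | zero => intro _; rwa [Nat.sub_zero, window_onesThen]
    | succ i ih =>
      intro hi
      refine hY.window_mem_of_succ ?_ ?_
      · rw [show n - 1 - (i + 1) + 1 = n - 1 - i by omega]; exact ih (by omega)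
      · rw [onesThen, dif_neg]; omega
  have := key (n - 1 - l) (by omega)
  rwa [show n - 1 - (n - 1 - l) = l by omega] at this

theorem liftBalanced [NeZero k] (hY : IsUnitClosed Y) (hn : 0 < n) : LiftBalanced Y := by
  obtain ⟨m, rfl⟩ := Nat.exists_eq_succ_of_ne_zero hn.ne'
  refine liftBalanced_of_next (fun c => c 0) (fun c hc => ?_) (fun c _ c' _ _ h => h)
  convert hY.shift c hc 1 using 1
  funext i
  rw [cyclicShift_apply]
  refine Fin.lastCases ?_ (fun i => ?_) i
  · rw [Fin.snoc_last]; congr 1; ext; simp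
  · rw [Fin.snoc_castSucc]
    simp only [Fin.tail]
    congr 1; ext; simp [Nat.mod_eq_of_lt (Nat.succ_lt_succ i.2)]

theorem liftConnected [NeZero k] (hY : IsUnitClosed Y) (b c : Tuple k (n + 1))
    (hb : lempel b ∈ Y) (hc : lempel c ∈ Y) : LiftLinked Y (Fin.init b) (Fin.init c) :=
  liftConnected_of_linked_ramp
    (fun _ hb => linked_ramp_of_thenOnes fun l _ => hY.window_thenOnes_mem hb l)
    (linked_ramp_succ_of_one_mem (hY.one_mem ⟨_, hb⟩)) b c hb hc

end IsUnitClosed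

/-! ### The comb: windows of the sequence with period `0, 1, …, 1` -/

variable {r : ℕ}

/-- The sequence with a `0` at every multiple of `r` and ones elsewhere. -/
def combSeq (k r : ℕ) : ℕ → ZMod k := fun i => if r ∣ i then 0 else 1

/-- The `n`-tuples of the periodic sequence with period `0, 1, …, 1` of length `r`. -/
def comb (k n r : ℕ) : Set (Tuple k n) := Set.range (window (combSeq k r) n)

theorem combSeq_add_period (i : ℕ) : combSeq k r (i + r) = combSeq k r i := by
  simp [combSeq]

theorem combSeq_eq_zero [Fact (1 < k)] {i : ℕ} : combSeq k r i = 0 ↔ r ∣ i := by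
  simp [combSeq]

theorem combSeq_eq_zero_or_one (i : ℕ) : combSeq k r i = 0 ∨ combSeq k r i = 1 := by
  unfold combSeq; split_ifs <;> simp

theorem combSeq_congr {i j : ℕ} (h : i ≡ j [MOD r]) : combSeq k r i = combSeq k r j := by
  simp only [combSeq, h.dvd_iff dvd_rfl]

theorem exists_lt_dvd_add (hr : 0 < r) (q : ℕ) : ∃ z < r, r ∣ q + z := by
  refine ⟨(r - q % r) % r, Nat.mod_lt _ hr, ?_⟩
  have := Nat.mod_lt q hr
  rw [Nat.dvd_iff_mod_eq_zero, Nat.add_mod, Nat.mod_mod, ← Nat.add_mod, Nat.add_mod_eq_ite]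
  rcases Nat.eq_zero_or_pos (q % r) with h | h
  · simp [h]
  · rw [Nat.mod_eq_of_lt (show r - q % r < r by omega)]
    split_ifs <;> omega

theorem modEq_of_dvd_add {q i j : ℕ} (hi : r ∣ q + i) (hj : r ∣ q + j) : i ≡ j [MOD r] :=
  Nat.ModEq.add_left_cancel' q
    (((Nat.modEq_zero_iff_dvd).2 hi).trans ((Nat.modEq_zero_iff_dvd).2 hj).symm)

theorem window_combSeq_eq_iff [Fact (1 < k)] (hr : 0 < r) (hrn : r ≤ n) (q q' : ℕ) :
    window (combSeq k r) n q = window (combSeq k r) n q' ↔ q ≡ q' [MOD r] := by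
  constructor
  · intro h
    obtain ⟨z, hz, hd⟩ := exists_lt_dvd_add hr q
    have := congrFun h ⟨z, by omega⟩
    simp only [window] at this
    rw [combSeq_eq_zero.2 hd, eq_comm, combSeq_eq_zero] at this
    exact Nat.ModEq.add_right_cancel' z
      (((Nat.modEq_zero_iff_dvd).2 hd).trans ((Nat.modEq_zero_iff_dvd).2 this).symm)
  · intro h
    funext i
    exact combSeq_congr (h.add_right _)

theorem ncard_comb [Fact (1 < k)] (hr : 0 < r) (hrn : r ≤ n) : (comb k n r).ncard = r := by
  have h : comb k n r = window (combSeq k r) n '' Set.Iio r := by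
    refine Set.Subset.antisymm ?_ (Set.image_subset_range _ _)
    rintro _ ⟨q, rfl⟩
    exact ⟨q % r, Nat.mod_lt _ hr, (window_combSeq_eq_iff hr hrn _ _).2 (Nat.mod_modEq q r)⟩
  rw [h, Set.InjOn.ncard_image, ← Finset.coe_Iio, Set.ncard_coe_finset, Nat.card_Iio]
  intro i hi j hj hij
  exact Nat.ModEq.eq_of_lt_of_lt ((window_combSeq_eq_iff hr hrn _ _).1 hij) hi hj

/-- The entry to append repeats the one at index `n - r`. The entry dropped repeats at index `r`,
which still lies in the window because `r < n`; so the tail determines it. -/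
theorem liftBalanced_comb [Fact (1 < k)] (hr : 0 < r) (hrn : r < n) :
    LiftBalanced (comb k n r) := by
  have : NeZero k := ⟨by have := Fact.out (p := 1 < k); omega⟩
  obtain ⟨m, rfl⟩ := Nat.exists_eq_succ_of_ne_zero (show n ≠ 0 by omega)
  refine liftBalanced_of_next (fun c => c ⟨m + 1 - r, by omega⟩) ?_ ?_
  · rintro _ ⟨q, rfl⟩
    refine ⟨q + 1, ?_⟩
    funext i
    refine Fin.lastCases ?_ (fun i => ?_) i
    · rw [Fin.snoc_last]
      simp only [window, Fin.val_last]
      rw [← combSeq_add_period (r := r) (q + (m + 1 - r))]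
      congr 1; omega
    · rw [Fin.snoc_castSucc]
      simp only [window, Fin.tail, Fin.val_castSucc, Fin.val_succ]
      congr 1; omega
  · rintro _ ⟨q, rfl⟩ _ ⟨q', rfl⟩ h -
    have := congrFun h ⟨r - 1, by omega⟩
    simp only [window, Fin.tail, Fin.succ_mk, Nat.sub_add_cancel hr, combSeq_add_period] at this
    simpa [window] using this

/-! ### Connectedness after removal of a comb -/

section RemoveComb

variable {Y : Set (Tuple k n)}

theorem onesThen_add (a : Tuple k n) (i : ℕ) (hi : i < n) :
    onesThen a (n - 1 + i) = a ⟨i, hi⟩ := by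
  rw [onesThen, dif_pos ⟨by omega, by omega⟩]; congr 2; omega

theorem onesThen_of_lt (a : Tuple k n) {l : ℕ} (h : l < n - 1) : onesThen a l = 1 := by
  rw [onesThen, dif_neg]; omega

theorem mem_comb_of_tail [Fact (1 < k)] {c : Tuple k n} {q : ℕ} (hn : 0 < n) (hr : 0 < r)
    (hq : ∀ l (hl : l + 1 < n), c ⟨l + 1, hl⟩ = combSeq k r (q + l))
    (h0 : c ⟨0, hn⟩ = combSeq k r (q + (r - 1))) : c ∈ comb k n r := by
  refine ⟨q + (r - 1), ?_⟩
  funext ⟨i, hi⟩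
  rcases i with _ | i
  · exact h0.symm
  · rw [hq i hi, ← combSeq_add_period (r := r) (q + i)]
    simp only [window]; congr 1; omega

/-- The hypothesis `z + r + 1 < n` says that the tail of `c` shows two zeros of the comb. They fix
the phase so rigidly that a comb window formed by ones followed by a prefix of `c` would force `c`
itself into the comb. -/
theorem window_onesThen_notMem_comb [Fact (1 < k)] {c : Tuple k n} {q z : ℕ} (hr : 0 < r)
    (hq : ∀ l (hl : l + 1 < n), c ⟨l + 1, hl⟩ = combSeq k r (q + l)) (hc : c ∉ comb k n r)
    (hz : z < r) (hqz : r ∣ q + z) (hzr : z + r + 1 < n) {l : ℕ} (hl : l < n) :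
    window (onesThen c) n l ∉ comb k n r := by
  rintro ⟨q', hq'⟩
  have he : ∀ m, m < n → onesThen c (l + m) = combSeq k r (q' + m) := fun m hm =>
    (congrFun hq' ⟨m, hm⟩).symm
  obtain ⟨i, rfl⟩ : ∃ i, n = l + i + 1 := ⟨n - 1 - l, by omega⟩
  have hu : ∀ j (hj : i + 1 + j < l + i + 1), combSeq k r (q' + (i + 1 + j)) =
      combSeq k r (q + j) := by
    intro j hj
    rw [← he _ hj, ← hq j (by omega), ← onesThen_add c (j + 1) (by omega)]
    congr 1; omega
  have h0 : c ⟨0, by omega⟩ = combSeq k r (q' + i) := by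
    rw [← he i (by omega), ← onesThen_add c 0 (by omega)]; congr 1
  -- The window is `i` ones, then `c 0`, then `l` entries of the tail. If `r ≤ l`, periodicity
  -- already determines `c 0` from the tail.
  by_cases hir : i + r < l + i + 1
  · refine hc (mem_comb_of_tail (by omega) hr hq ?_)
    rw [h0, ← hu (r - 1) (by omega), ← combSeq_add_period (r := r) (q' + i)]
    congr 1; omega
  obtain ⟨ζ, hζ, hdζ⟩ := exists_lt_dvd_add hr q'
  have hiζ : i ≤ ζ := by
    by_contra hlt
    have := he ζ (by omega)
    rw [onesThen_of_lt _ (by omega), combSeq_eq_zero.2 hdζ] at this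
    exact one_ne_zero this
  -- Either `c 0` is the first zero, and the zero of the tail at `z` follows too soon, or the first
  -- zero lies in the tail at `w = z`, and both `c 0` and the entry the comb would place before the
  -- tail are `1`.
  rcases hiζ.eq_or_lt with rfl | hlt
  · have h1 := hu z (by omega)
    rw [combSeq_eq_zero.2 hqz, combSeq_eq_zero] at h1
    have := modEq_of_dvd_add hdζ h1
    rw [Nat.modEq_iff_dvd' (by omega)] at this
    have := Nat.le_of_dvd (by omega) this
    omega
  · obtain ⟨w, rfl⟩ : ∃ w, ζ = i + 1 + w := ⟨ζ - i - 1, by omega⟩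
    have h1 := hu w (by omega)
    rw [combSeq_eq_zero.2 hdζ, eq_comm, combSeq_eq_zero] at h1
    have hwz : w = z := Nat.ModEq.eq_of_lt_of_lt (modEq_of_dvd_add h1 hqz) (by omega) hz
    subst hwz
    refine hc (mem_comb_of_tail (by omega) hr hq ?_)
    have h2 : ¬ r ∣ q' + i := fun h => by
      have := modEq_of_dvd_add h hdζ
      rw [Nat.modEq_iff_dvd' (by omega)] at this
      have := Nat.le_of_dvd (by omega) this
      omega
    have h3 : ¬ r ∣ q + (r - 1) := fun h => by
      have := modEq_of_dvd_add hqz h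
      rw [Nat.modEq_iff_dvd' (by omega)] at this
      have := Nat.le_of_dvd (by omega) this
      omega
    rw [h0, combSeq, combSeq, if_neg h2, if_neg h3]

/-- From a vertex whose differences are those of a comb, going forward may use a removed edge, so
ramps are sought backwards by prepending ones. -/
theorem linked_ramp_of_tail_comb [Fact (2 < k)] (hY : IsUnitClosed Y) (hr : 0 < r) (hrn : r < n)
    (hpair : ∀ i j, Function.update (Function.update (1 : Tuple k n) j 0) i 2 ∈ Y)
    {b : Tuple k (n + 1)} (hb : lempel b ∈ Y \ comb k n r) {q : ℕ}
    (hq : ∀ l (hl : l + 1 < n), lempel b ⟨l + 1, hl⟩ = combSeq k r (q + l)) :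
    ∃ x, LiftLinked (Y \ comb k n r) (Fin.tail b) (ramp k n x) := by
  have hk2 := Fact.out (p := 2 < k)
  have : Fact (1 < k) := ⟨by omega⟩
  have hn : 0 < n := by omega
  have : NeZero n := ⟨by omega⟩
  obtain ⟨z, hz, hqz⟩ := exists_lt_dvd_add hr q
  by_cases hzr : z + r + 1 < n
  · exact linked_ramp_of_onesThen fun l hl => ⟨hY.window_onesThen_mem hb.1 hl,
      window_onesThen_notMem_comb hr hq hb.2 hz hqz hzr hl⟩
  -- The tail shows a single zero here. Another edge into the same vertex is used, with first
  -- difference `2`; every window of the backward walk then contains this `2`, which no comb tuple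
  -- does.
  let b' : Tuple k (n + 1) := Fin.cons (Fin.tail b ⟨0, hn⟩ - 2) (Fin.tail b)
  have hb' : Fin.tail b' = Fin.tail b := Fin.tail_cons _ _
  have hlb' : lempel b' = Function.update (Function.update (1 : Tuple k n) ⟨z + 1, by omega⟩ 0)
      ⟨0, hn⟩ 2 := by
    funext ⟨i, hi⟩
    rcases i with _ | i
    · have : (⟨0, hi⟩ : Fin n).castSucc = 0 := rfl
      rw [Function.update_self, lempel_apply, this]
      change Fin.tail b ⟨0, hi⟩ - (Fin.tail b ⟨0, hn⟩ - 2) = 2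
      ring
    · have h1 : lempel b' ⟨i + 1, hi⟩ = lempel b ⟨i + 1, hi⟩ := by
        rw [lempel_apply, lempel_apply]
        have e1 := congrFun hb' ⟨i + 1, hi⟩
        have e2 := congrFun hb' ⟨i, by omega⟩
        simp only [Fin.tail] at e1 e2
        rw [e1]
        exact congrArg _ e2
      rw [h1, hq, Function.update_of_ne (by simp [Fin.ext_iff]), Function.update_apply]
      have h2 : r ∣ q + i ↔ i = z := by
        constructor
        · intro h
          have h3 := modEq_of_dvd_add hqz h
          rcases lt_or_ge i z with h4 | h4
          · exact Nat.ModEq.eq_of_lt_of_lt h3.symm (by omega) hz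
          · rw [Nat.modEq_iff_dvd' h4] at h3
            rcases Nat.eq_zero_or_pos (i - z) with h5 | h5
            · omega
            · have := Nat.le_of_dvd h5 h3
              omega
        · rintro rfl; exact hqz
      simp [combSeq, h2]
  rw [← hb']
  refine linked_ramp_of_onesThen fun l hl => ⟨hY.window_onesThen_mem (hlb' ▸ hpair _ _) hl, ?_⟩
  rintro ⟨q', hq'⟩
  have h1 := congrFun hq' ⟨n - 1 - l, by omega⟩
  have h2 : window (onesThen (lempel b')) n l ⟨n - 1 - l, by omega⟩ = 2 := by
    simp only [window]
    rw [show l + (n - 1 - l) = n - 1 + 0 by omega, onesThen_add _ 0 hn, hlb',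
      Function.update_self]
  rw [h2] at h1
  have h20 : (2 : ZMod k) ≠ 0 := by
    intro h
    have := (ZMod.natCast_eq_zero_iff 2 k).1 (by exact_mod_cast h)
    exact absurd (Nat.le_of_dvd two_pos this) (by omega)
  have h21 : (2 : ZMod k) ≠ 1 := by
    intro h
    have : (1 : ZMod k) = 0 := by linear_combination h
    exact one_ne_zero this
  rcases combSeq_eq_zero_or_one (k := k) (r := r) (q' + (n - 1 - l)) with h | h
  · exact h20 (h1.symm.trans h)
  · exact h21 (h1.symm.trans h)

/-- Ones are appended until the next edge would be a removed one. The vertex reached then has comb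
differences, and `linked_ramp_of_tail_comb` leads from it to a ramp. -/
theorem linked_ramp_diff_comb [Fact (2 < k)] (hY : IsUnitClosed Y) (hr : 0 < r) (hrn : r < n)
    (hpair : ∀ i j, Function.update (Function.update (1 : Tuple k n) j 0) i 2 ∈ Y)
    {b : Tuple k (n + 1)} (hb : lempel b ∈ Y \ comb k n r) :
    ∃ x, LiftLinked (Y \ comb k n r) (Fin.init b) (ramp k n x) := by
  classical
  by_cases hex : ∃ l, l < n ∧ window (thenOnes (lempel b)) n l ∈ comb k n r
  · let l := Nat.find hex
    have hl := Nat.find_spec hex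
    have hmin : ∀ m < l, window (thenOnes (lempel b)) n m ∈ Y \ comb k n r := fun m hm =>
      ⟨hY.window_thenOnes_mem hb.1 m, fun h => Nat.find_min hex hm ⟨hm.trans hl.1, h⟩⟩
    change l < n ∧ window (thenOnes (lempel b)) n l ∈ comb k n r at hl
    have hl0 : 0 < l := by
      refine Nat.pos_of_ne_zero fun h => hb.2 ?_
      have := hl.2
      rwa [h, window_thenOnes_zero] at this
    obtain ⟨s, hs, hsb⟩ := exists_isLiftOf_window (window_thenOnes_zero (lempel b)).symm
    obtain ⟨q, hq⟩ := hl.2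
    obtain ⟨x, hx⟩ := linked_ramp_of_tail_comb hY hr hrn hpair (b := window s (n + 1) (l - 1))
      (by rw [hs.lempel_window]; exact hmin _ (by omega)) (q := q) (by
        intro m hm
        have h1 := congrFun hq ⟨m, by omega⟩
        rw [hs.lempel_window]
        simp only [window] at h1 ⊢
        rw [h1]; congr 1; omega)
    rw [window_succ_tail, Nat.sub_add_cancel hl0] at hx
    refine ⟨x, LiftLinked.trans ?_ hx⟩
    rw [← hsb, window_succ_init]
    exact hs.liftLinked (Nat.zero_le _) fun m _ hm => hmin m hm
  · push Not at hex
    exact linked_ramp_of_thenOnes fun l hl => ⟨hY.window_thenOnes_mem hb.1 l, hex l hl⟩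

theorem liftConnected_diff_comb [Fact (2 < k)] (hY : IsUnitClosed Y) (hr : 1 < r) (hrn : r < n)
    (hpair : ∀ i j, Function.update (Function.update (1 : Tuple k n) j 0) i 2 ∈ Y)
    (b c : Tuple k (n + 1)) (hb : lempel b ∈ Y \ comb k n r) (hc : lempel c ∈ Y \ comb k n r) :
    LiftLinked (Y \ comb k n r) (Fin.init b) (Fin.init c) := by
  have hk2 := Fact.out (p := 2 < k)
  have : Fact (1 < k) := ⟨by omega⟩
  have : NeZero k := ⟨by omega⟩
  refine liftConnected_of_linked_ramp
    (fun _ hb => linked_ramp_diff_comb hY (by omega) hrn hpair hb)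
    (linked_ramp_succ_of_one_mem ⟨hY.one_mem ⟨_, hb.1⟩, ?_⟩) b c hb hc
  rintro ⟨q, hq⟩
  obtain ⟨z, hz, hd⟩ := exists_lt_dvd_add (r := r) (by omega) q
  have := congrFun hq ⟨z, by omega⟩
  simp only [window, combSeq_eq_zero.2 hd] at this
  exact zero_ne_one this

end RemoveComb

/-! ### Connectedness after removal of the all-ones tuple -/

section RemoveLoop

variable {Y : Set (Tuple k n)}

theorem liftBalanced_one [NeZero k] (hn : 0 < n) : LiftBalanced ({1} : Set (Tuple k n)) := by
  obtain ⟨m, rfl⟩ := Nat.exists_eq_succ_of_ne_zero hn.ne'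
  refine liftBalanced_of_next (fun _ => 1) ?_ ?_
  · rintro c rfl
    rw [Set.mem_singleton_iff]
    funext i
    refine Fin.lastCases ?_ (fun i => ?_) i
    · simp
    · simp [Fin.tail]
  · rintro c rfl c' rfl - -
    rfl

theorem linked_ramp_diff_one (hY : IsUnitClosed Y) {b : Tuple k (n + 1)}
    (hb : lempel b ∈ Y \ {1}) : ∃ x, LiftLinked (Y \ {1}) (Fin.init b) (ramp k n x) := by
  classical
  have hex : ∃ l, window (thenOnes (lempel b)) n l = 1 :=
    ⟨n, by funext i; simp [window, thenOnes]⟩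
  obtain ⟨s, hs, hsb⟩ := exists_isLiftOf_window (window_thenOnes_zero (lempel b)).symm
  obtain ⟨l, hl, hmin⟩ : ∃ l, window (thenOnes (lempel b)) n l = 1 ∧
      ∀ m < l, window (thenOnes (lempel b)) n m ≠ 1 :=
    ⟨Nat.find hex, Nat.find_spec hex, fun m hm => Nat.find_min hex hm⟩
  refine ⟨s l, ?_⟩
  rw [← hsb, window_succ_init, ← hs.window_eq_ramp (n := n)]
  · exact hs.liftLinked (Nat.zero_le _) fun m _ hm =>
      ⟨hY.window_thenOnes_mem hb.1 m, hmin m hm⟩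
  · intro i hi
    exact congrFun hl ⟨i, by omega⟩

theorem liftConnected_diff_one [Fact (2 < k)] (hn : 4 ≤ n) (hY : IsUnitClosed Y)
    (hbin : ∀ a : Tuple k n, a ≠ 0 → (∀ i, a i = 0 ∨ a i = 1) → a ∈ Y)
    (b c : Tuple k (n + 1)) (hb : lempel b ∈ Y \ {1}) (hc : lempel c ∈ Y \ {1}) :
    LiftLinked (Y \ {1}) (Fin.init b) (Fin.init c) := by
  have hk2 := Fact.out (p := 2 < k)
  have : Fact (1 < k) := ⟨by omega⟩
  have : NeZero k := ⟨by omega⟩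
  refine liftConnected_of_linked_ramp (fun _ hb => linked_ramp_diff_one hY hb) ?_ b c hb hc
  have hmem : ∀ (d : ℕ → ZMod k) (l i j : ℕ), (∀ m, d m = 0 ∨ d m = 1) → i < n → j < n →
      d (l + i) = 0 → d (l + j) = 1 → window d n l ∈ Y \ {1} := by
    intro d l i j hd hi hj h0 h1
    refine ⟨hbin _ (fun h => ?_) fun m => hd _, fun h => ?_⟩
    · have := congrFun h ⟨j, hj⟩
      simp only [window, h1] at this
      exact one_ne_zero this
    · have := congrFun h ⟨i, hi⟩
      simp only [window, h0] at this
      exact zero_ne_one this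
  -- Ramps are no longer linked directly. One zero among `n` differences advances the ramp by `n -
  -- 1`; two zeros among `n + 2` differences advance it by `n`. The two together link `x` to `x +
  -- 1`.
  have hw1 : ∀ x, LiftLinked (Y \ {1}) (ramp k n x) (ramp k n (x + (n - 1 : ℕ))) := by
    intro x
    let d : ℕ → ZMod k := fun l => if l = n - 1 then 0 else 1
    obtain ⟨s, hs, h0⟩ := exists_isLiftOf d x 0
    have h := hs.liftLinked (Z := Y \ {1}) (Nat.zero_le n) fun l _ hl => by
      rcases Nat.lt_or_ge l (n - 1) with h1 | h1
      · exact hmem d l (n - 1 - l) 0 (fun m => by simp only [d]; split_ifs <;> simp) (by omega)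
          (by omega) (if_pos (by omega)) (if_neg (by omega))
      · exact hmem d l (n - 1 - l) 1 (fun m => by simp only [d]; split_ifs <;> simp) (by omega)
          (by omega) (if_pos (by omega)) (if_neg (by omega))
    rw [hs.window_eq_ramp (fun i hi => if_neg (by omega)),
      hs.window_eq_ramp (fun i hi => if_neg (by omega)), hs.eq_add_sum n, h0] at h
    convert h using 3
    obtain ⟨m, rfl⟩ : ∃ m, n = m + 1 := ⟨n - 1, by omega⟩
    rw [Finset.sum_range_succ, Finset.sum_congr rfl (g := fun _ => 1)]
    · simp [d]
    · intro i hi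
      exact if_neg (by have := Finset.mem_range.1 hi; omega)
  have hw2 : ∀ x, LiftLinked (Y \ {1}) (ramp k n x) (ramp k n (x + n)) := by
    intro x
    -- With the zeros at `n - 1` and `n + 1`, each of the `n + 2` windows contains both a `0` and a
    -- `1`.
    let d : ℕ → ZMod k := fun l => if l = n - 1 ∨ l = n + 1 then 0 else 1
    have hd : ∀ m, d m = 0 ∨ d m = 1 := fun m => by simp only [d]; split_ifs <;> simp
    obtain ⟨s, hs, h0⟩ := exists_isLiftOf d x 0
    have h := hs.liftLinked (Z := Y \ {1}) (Nat.zero_le (n + 2)) fun l _ hl => by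
      rcases Nat.lt_or_ge l (n - 1) with h1 | h1
      · exact hmem d l (n - 1 - l) 0 hd (by omega)
          (by omega) (if_pos (by omega)) (if_neg (by omega))
      rcases h1.eq_or_lt with h1 | h1
      · exact hmem d l 0 1 hd (by omega)
          (by omega) (if_pos (by omega)) (if_neg (by omega))
      rcases (Nat.succ_le_of_lt h1).eq_or_lt with h1 | h1
      · exact hmem d l 1 0 hd (by omega)
          (by omega) (if_pos (by omega)) (if_neg (by omega))
      · exact hmem d l 0 1 hd (by omega)
          (by omega) (if_pos (by omega)) (if_neg (by omega))
    rw [hs.window_eq_ramp (fun i hi => if_neg (by omega)),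
      hs.window_eq_ramp (fun i hi => if_neg (by omega)), hs.eq_add_sum (n + 2), h0] at h
    convert h using 3
    obtain ⟨m, rfl⟩ : ∃ m, n = m + 1 := ⟨n - 1, by omega⟩
    rw [Finset.sum_range_succ, Finset.sum_range_succ, Finset.sum_range_succ,
      Finset.sum_congr rfl (g := fun _ => 1)]
    · simp [d]
    · intro i hi
      exact if_neg (by have := Finset.mem_range.1 hi; omega)
  intro x
  have h1 := hw1 (x - (n - 1 : ℕ))
  have h2 := hw2 (x - (n - 1 : ℕ))
  rw [sub_add_cancel] at h1
  have h3 := h1.symm.trans h2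
  convert h3 using 2
  rw [Nat.cast_sub (by omega)]
  push_cast; ring

end RemoveLoop

/-- Removing fewer than `n` edges from a large closed set of edges, without destroying
connectedness. -/
theorem exists_connected_subset [Fact (2 < k)] (hn : 4 ≤ n) {Y : Set (Tuple k n)}
    (hY : IsUnitClosed Y)
    (hbin : ∀ a : Tuple k n, a ≠ 0 → (∀ i, a i = 0 ∨ a i = 1) → a ∈ Y)
    (hpair : ∀ i j, Function.update (Function.update (1 : Tuple k n) j 0) i 2 ∈ Y)
    (hr : r < n) :
    ∃ Z ⊆ Y, Z.ncard + r = Y.ncard ∧ LiftBalanced Z ∧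
      ∀ b c : Tuple k (n + 1), lempel b ∈ Z → lempel c ∈ Z →
        LiftLinked Z (Fin.init b) (Fin.init c) := by
  have hk2 := Fact.out (p := 2 < k)
  have : Fact (1 < k) := ⟨by omega⟩
  have : NeZero k := ⟨by omega⟩
  have hbal := hY.liftBalanced (by omega)
  have h1 : (1 : Tuple k n) ∈ Y :=
    hbin _ (fun h => one_ne_zero (congrFun h ⟨0, by omega⟩)) fun _ => Or.inr rfl
  rcases Nat.eq_zero_or_pos r with rfl | hr0
  · exact ⟨Y, subset_rfl, rfl, hbal, hY.liftConnected⟩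
  -- The comb with `r = 1` would be the zero tuple, which need not belong to `Y`; the all-ones tuple
  -- is removed instead.
  rcases (Nat.succ_le_of_lt hr0).eq_or_lt with hr1 | hr1
  · refine ⟨Y \ {1}, Set.sdiff_subset, ?_, ?_, liftConnected_diff_one hn hY hbin⟩
    · rw [← Set.ncard_sdiff_singleton_add_one h1, ← hr1]
    · exact hbal.diff (liftBalanced_one (by omega)) (Set.singleton_subset_iff.2 h1)
  · have hsub : comb k n r ⊆ Y := by
      rintro _ ⟨q, rfl⟩
      refine hbin _ (fun h => ?_) fun i => combSeq_eq_zero_or_one _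
      have h0 : r ∣ q := by
        have := congrFun h ⟨0, by omega⟩
        exact combSeq_eq_zero.1 this
      have h1 : r ∣ q + 1 := by
        have := congrFun h ⟨1, by omega⟩
        exact combSeq_eq_zero.1 this
      have := Nat.le_of_dvd one_pos ((Nat.dvd_add_right h0).1 h1)
      omega
    refine ⟨Y \ comb k n r, Set.sdiff_subset, ?_, hbal.diff (liftBalanced_comb hr0 hr) hsub,
      liftConnected_diff_comb hY hr1 hr hpair⟩
    have := Set.ncard_sdiff_add_ncard_of_subset hsub
    rwa [ncard_comb hr0 hr.le] at this

/-! ### Pseudoweight -/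

section Weight

/-- The contribution of an entry to the pseudoweight. -/
def entryWeight (x : ZMod k) : ℚ := if x = 0 then (k : ℚ) / 2 else (x.val : ℚ)

theorem pseudoweight_eq_sum (u : Tuple k n) : pseudoweight u = ∑ i, entryWeight (u i) := rfl

theorem entryWeight_neg [NeZero k] (x : ZMod k) : entryWeight (-x) = k - entryWeight x := by
  unfold entryWeight
  by_cases h : x = 0
  · simp [h]; ring
  · have : NeZero x := ⟨h⟩
    rw [if_neg h, if_neg (by simpa using h), ZMod.val_neg_of_ne_zero,
      Nat.cast_sub (ZMod.val_lt x).le]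

theorem pseudoweight_neg_reverse [NeZero k] (u : Tuple k n) :
    pseudoweight (-reverse u) = k * n - pseudoweight u := by
  simp only [pseudoweight_eq_sum, Pi.neg_apply, entryWeight_neg, Finset.sum_sub_distrib, reverse]
  rw [← Equiv.sum_comp Fin.revPerm (fun i => entryWeight (u i))]
  simp [mul_comm]

theorem pseudoweight_cyclicShift (u : Tuple k n) (c : ℕ) :
    pseudoweight (cyclicShift u c) = pseudoweight u :=
  Equiv.sum_comp (finRotate n ^ c) (fun i => entryWeight (u i))

theorem entryWeight_one [Fact (2 < k)] : entryWeight (1 : ZMod k) = 1 := by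
  have : Fact (1 < k) := ⟨by have := Fact.out (p := 2 < k); omega⟩
  simp [entryWeight, ZMod.val_one]

/-- The entry `0` weighs `k / 2`, which exceeds `1` only for `k ≥ 3`. -/
theorem one_lt_entryWeight [Fact (2 < k)] {x : ZMod k} (hx : x ≠ 1) : 1 < entryWeight x := by
  have hk := Fact.out (p := 2 < k)
  have : Fact (1 < k) := ⟨by omega⟩
  unfold entryWeight
  split_ifs with h
  · have : (2 : ℚ) < k := by exact_mod_cast hk
    linarith
  · have h0 : x.val ≠ 0 := by rwa [Ne, ZMod.val_eq_zero]
    have h1 : x.val ≠ 1 := fun h1 => hx (ZMod.val_injective k (by rw [h1, ZMod.val_one]))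
    exact_mod_cast (show 1 < x.val by omega)

theorem pseudoweight_update (u : Tuple k n) (i : Fin n) (x : ZMod k) :
    pseudoweight (Function.update u i x) = pseudoweight u - entryWeight (u i) + entryWeight x := by
  rw [pseudoweight_eq_sum, pseudoweight_eq_sum,
    ← Finset.add_sum_erase _ _ (Finset.mem_univ i), ← Finset.add_sum_erase _ (fun j =>
      entryWeight (u j)) (Finset.mem_univ i), Function.update_self,
    Finset.sum_congr rfl (g := fun j => entryWeight (u j))]
  · ring
  · intro j hj
    rw [Function.update_of_ne (Finset.ne_of_mem_erase hj)]

theorem pseudoweight_update_one_lt [Fact (2 < k)] {u : Tuple k n} {i : Fin n} (h : u i ≠ 1) :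
    pseudoweight (Function.update u i 1) < pseudoweight u := by
  rw [pseudoweight_update, entryWeight_one]
  linarith [one_lt_entryWeight h]

end Weight

/-! ### Circuits and the involution `a ↦ -a^R` -/

section Circuits

theorem neg_reverse_neg_reverse (a : Tuple k n) : -reverse (-reverse a) = a := by
  funext i; simp [reverse]

theorem neg_reverse_injective : Function.Injective fun a : Tuple k n => -reverse a :=
  Function.Involutive.injective neg_reverse_neg_reverse

theorem cyclicShift_neg_reverse_cyclicShift (a : Tuple k n) (c : ℕ) :
    cyclicShift (-reverse (cyclicShift a c)) c = -reverse a := by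
  funext i
  rw [cyclicShift_apply, Pi.neg_apply, Pi.neg_apply, reverse, reverse, cyclicShift_apply]
  congr 2
  ext
  simp only [Fin.val_rev]
  have hi := i.2
  have h := Nat.div_add_mod (i + c) n
  have hlt := Nat.mod_lt (i + c) i.pos
  have : n - ((i + c) % n + 1) + c = n - (i + 1) + n * ((i + c) / n) := by omega
  rw [this, Nat.add_mul_mod_self_left, Nat.mod_eq_of_lt (by omega)]

/-- Reversal turns a shift by `c` into a shift by `-c`, written `c * (n - 1)` modulo `n`. -/
theorem neg_reverse_cyclicShift (a : Tuple k n) (c : ℕ) :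
    -reverse (cyclicShift a c) = cyclicShift (-reverse a) (c * (n - 1)) := by
  rcases Nat.eq_zero_or_pos n with rfl | hn
  · exact Subsingleton.elim _ _
  rw [← cyclicShift_neg_reverse_cyclicShift a c, cyclicShift_cyclicShift,
    show c + c * (n - 1) = c * n by
      obtain ⟨m, rfl⟩ := Nat.exists_eq_succ_of_ne_zero hn.ne'
      simp; ring, cyclicShift_mul_self]

theorem mem_circuit_self (a : Tuple k n) : a ∈ circuit a := ⟨0, cyclicShift_zero a⟩

theorem cyclicShift_mem_circuit (a : Tuple k n) (c : ℕ) : cyclicShift a c ∈ circuit a := ⟨c, rfl⟩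

theorem mem_circuit_comm {a b : Tuple k n} : b ∈ circuit a ↔ a ∈ circuit b := by
  suffices ∀ {a b : Tuple k n}, b ∈ circuit a → a ∈ circuit b from ⟨this, this⟩
  rintro a _ ⟨c, rfl⟩
  rcases Nat.eq_zero_or_pos n with rfl | hn
  · exact ⟨0, Subsingleton.elim _ _⟩
  refine ⟨c * (n - 1), ?_⟩
  rw [cyclicShift_cyclicShift, show c + c * (n - 1) = c * n by
      obtain ⟨m, rfl⟩ := Nat.exists_eq_succ_of_ne_zero hn.ne'
      simp; ring, cyclicShift_mul_self]

theorem circuit_eq_of_mem {a b : Tuple k n} (h : b ∈ circuit a) : circuit b = circuit a := by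
  have : ∀ {a b : Tuple k n}, b ∈ circuit a → circuit b ⊆ circuit a := by
    rintro a _ ⟨c, rfl⟩ _ ⟨d, rfl⟩
    exact ⟨c + d, (cyclicShift_cyclicShift a c d).symm⟩
  exact (this h).antisymm (this (mem_circuit_comm.1 h))

theorem circuit_eq_iff {a b : Tuple k n} : circuit b = circuit a ↔ b ∈ circuit a :=
  ⟨fun h => h ▸ mem_circuit_self b, circuit_eq_of_mem⟩

theorem circuit_cyclicShift (a : Tuple k n) (c : ℕ) : circuit (cyclicShift a c) = circuit a :=
  circuit_eq_of_mem (cyclicShift_mem_circuit a c)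

theorem pseudoweight_of_mem_circuit {a b : Tuple k n} (h : b ∈ circuit a) :
    pseudoweight b = pseudoweight a := by
  obtain ⟨c, rfl⟩ := h
  exact pseudoweight_cyclicShift a c

theorem reverseComplement_circuit (a : Tuple k n) :
    reverseComplement (circuit a) = circuit (-reverse a) := by
  apply Set.Subset.antisymm
  · rintro _ ⟨_, ⟨c, rfl⟩, rfl⟩
    exact ⟨_, (neg_reverse_cyclicShift a c).symm⟩
  · rintro _ ⟨c, rfl⟩
    refine ⟨-reverse (cyclicShift (-reverse a) c), ?_, neg_reverse_neg_reverse _⟩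
    rw [neg_reverse_cyclicShift, neg_reverse_neg_reverse]
    exact cyclicShift_mem_circuit _ _

theorem reverseComplement_reverseComplement (C : Set (Tuple k n)) :
    reverseComplement (reverseComplement C) = C := by
  simp [reverseComplement, Set.image_image, neg_reverse_neg_reverse]

theorem isNegasymmetricCircuit_circuit {a : Tuple k n} :
    IsNegasymmetricCircuit (circuit a) ↔ -reverse a ∈ circuit a := by
  constructor
  · rintro ⟨b, hb, c, hc, rfl⟩
    rw [← circuit_eq_iff, ← reverseComplement_circuit, ← circuit_eq_of_mem hc,
      reverseComplement_circuit, circuit_eq_of_mem hb, circuit_eq_of_mem hc]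
  · intro h
    exact ⟨_, h, a, mem_circuit_self a, rfl⟩

/-- The tuples lying on a negasymmetric circuit. -/
def negaTuples (k n : ℕ) : Set (Tuple k n) := {a | -reverse a ∈ circuit a}

theorem mem_midEdges_of_mem_negaTuples [NeZero k] {a : Tuple k n} (h : a ∈ negaTuples k n) :
    a ∈ midEdges k n := by
  have h1 := pseudoweight_of_mem_circuit h
  rw [pseudoweight_neg_reverse] at h1
  change pseudoweight a = k * n / 2
  linarith

theorem circuit_mem_circuits {a : Tuple k n} : circuit a ∈ circuits k n ↔ a ∈ midEdges k n := by
  constructor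
  · rintro ⟨b, hb, hab⟩
    change pseudoweight a = _
    rw [pseudoweight_of_mem_circuit (circuit_eq_iff.1 hab.symm)]
    exact hb
  · exact fun h => ⟨a, h, rfl⟩

theorem circuit_mem_nonNegaCircuits {a : Tuple k n} :
    circuit a ∈ nonNegaCircuits k n ↔ a ∈ midEdges k n ∧ a ∉ negaTuples k n := by
  change circuit a ∈ circuits k n ∧ ¬ IsNegasymmetricCircuit (circuit a) ↔ _
  rw [circuit_mem_circuits, isNegasymmetricCircuit_circuit]
  rfl

theorem exists_of_mem_nonNegaCircuits {C : Set (Tuple k n)} (h : C ∈ nonNegaCircuits k n) :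
    ∃ a, C = circuit a ∧ a ∈ midEdges k n ∧ a ∉ negaTuples k n := by
  obtain ⟨a, ha, rfl⟩ := h.1
  exact ⟨a, rfl, circuit_mem_nonNegaCircuits.1 h⟩

theorem neg_reverse_mem_midEdges [NeZero k] {a : Tuple k n} (h : a ∈ midEdges k n) :
    -reverse a ∈ midEdges k n := by
  change pseudoweight _ = _
  rw [pseudoweight_neg_reverse, show pseudoweight a = _ from h]
  ring

theorem neg_reverse_mem_negaTuples {a : Tuple k n} :
    -reverse a ∈ negaTuples k n ↔ a ∈ negaTuples k n := by
  change -reverse (-reverse a) ∈ circuit (-reverse a) ↔ -reverse a ∈ circuit a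
  rw [neg_reverse_neg_reverse, mem_circuit_comm]

theorem reverseComplement_mem_nonNegaCircuits [NeZero k] {C : Set (Tuple k n)}
    (h : C ∈ nonNegaCircuits k n) : reverseComplement C ∈ nonNegaCircuits k n := by
  obtain ⟨a, rfl, ha, ha'⟩ := exists_of_mem_nonNegaCircuits h
  rw [reverseComplement_circuit, circuit_mem_nonNegaCircuits, neg_reverse_mem_negaTuples]
  exact ⟨neg_reverse_mem_midEdges ha, ha'⟩

end Circuits

/-! ### The sets `X_k(n-1)` -/

section Extensions

theorem exists_isExtension [NeZero k] : ∃ X : Set (Tuple k n), IsExtension k n X := by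
  classical
  -- A well-order selects the smaller circuit of each pair.
  let r : Set (Tuple k n) → Set (Tuple k n) → Prop := WellOrderingRel
  refine ⟨_, {C ∈ nonNegaCircuits k n | r C (reverseComplement C)}, fun C hC => hC.1, ?_, rfl⟩
  intro C hC
  have hne : C ≠ reverseComplement C := by
    obtain ⟨a, rfl, ha, ha'⟩ := exists_of_mem_nonNegaCircuits hC
    intro h
    rw [reverseComplement_circuit, eq_comm, circuit_eq_iff] at h
    exact ha' h
  have hC' := reverseComplement_mem_nonNegaCircuits hC
  simp only [Set.mem_ofPred_eq, hC, hC', true_and, reverseComplement_reverseComplement]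
  rcases trichotomous_of r C (reverseComplement C) with h | h | h
  · exact Or.inl ⟨h, asymm_of r h⟩
  · exact absurd h hne
  · exact Or.inr ⟨h, asymm_of r h⟩

variable {X : Set (Tuple k n)}

theorem IsExtension.exists_mem_iff (hX : IsExtension k n X) :
    ∃ S ⊆ nonNegaCircuits k n,
      (∀ C ∈ nonNegaCircuits k n, Xor (C ∈ S) (reverseComplement C ∈ S)) ∧
      ∀ a, a ∈ X ↔ pseudoweight a < (k : ℚ) * n / 2 ∨ circuit a ∈ S := by
  obtain ⟨S, hS, hxor, rfl⟩ := hX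
  refine ⟨S, hS, hxor, fun a => or_congr Iff.rfl ⟨?_, fun h => ⟨_, h, mem_circuit_self a⟩⟩⟩
  rintro ⟨C, hC, haC⟩
  obtain ⟨b, rfl, -⟩ := exists_of_mem_nonNegaCircuits (hS hC)
  rwa [circuit_eq_of_mem haC]

theorem IsExtension.pseudoweight_le (hX : IsExtension k n X) {a : Tuple k n} (ha : a ∈ X) :
    pseudoweight a ≤ (k : ℚ) * n / 2 := by
  obtain ⟨S, hS, -, h⟩ := hX.exists_mem_iff
  rcases (h a).1 ha with h | h
  · exact h.le
  · exact (circuit_mem_nonNegaCircuits.1 (hS h)).1.le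

theorem IsExtension.mem_of_low (hX : IsExtension k n X) {a : Tuple k n}
    (ha : pseudoweight a < (k : ℚ) * n / 2) : a ∈ X := by
  obtain ⟨S, -, -, h⟩ := hX.exists_mem_iff
  exact (h a).2 (Or.inl ha)

/-- Replacing an entry other than `1` strictly lowers the weight, so the result lies in `E_k(n-1)`
whichever circuits were chosen. -/
theorem IsExtension.isUnitClosed [Fact (2 < k)] (hX : IsExtension k n X) : IsUnitClosed X := by
  constructor
  · intro a ha c
    obtain ⟨S, -, -, h⟩ := hX.exists_mem_iff
    rw [h] at ha ⊢
    rwa [pseudoweight_cyclicShift, circuit_cyclicShift]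
  · intro a ha i
    by_cases h : a i = 1
    · rwa [← h, Function.update_eq_self]
    · exact hX.mem_of_low ((pseudoweight_update_one_lt h).trans_le (hX.pseudoweight_le ha))

theorem IsExtension.ne_neg_reverse [NeZero k] (hX : IsExtension k n X) :
    ∀ a ∈ X, ∀ b ∈ X, a ≠ -reverse b := by
  rintro _ ha b hb rfl
  have h1 := hX.pseudoweight_le ha
  have h2 := hX.pseudoweight_le hb
  rw [pseudoweight_neg_reverse] at h1
  obtain ⟨S, hS, hxor, h⟩ := hX.exists_mem_iff
  rw [h, pseudoweight_neg_reverse] at ha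
  rw [h] at hb
  have ha' := ha.resolve_left (by linarith)
  have hb' := hb.resolve_left (by linarith)
  rw [← reverseComplement_circuit] at ha'
  rcases hxor _ (hS hb') with h | h
  · exact h.2 ha'
  · exact h.2 hb'

/-- All tuples split into `X`, its image under `a ↦ -a^R`, and those on negasymmetric circuits. -/
theorem IsExtension.two_mul_ncard_add [NeZero k] (hX : IsExtension k n X) :
    2 * X.ncard + (negaTuples k n).ncard = k ^ n := by
  have hcover : X ∪ (fun a => -reverse a) '' X ∪ negaTuples k n = Set.univ := by
    obtain ⟨S, -, hxor, h⟩ := hX.exists_mem_iff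
    refine Set.eq_univ_of_forall fun a => ?_
    by_cases hN : a ∈ negaTuples k n
    · exact Or.inr hN
    refine Or.inl ?_
    have hmem : -reverse a ∈ X → a ∈ (fun a => -reverse a) '' X := fun h =>
      ⟨_, h, neg_reverse_neg_reverse a⟩
    rcases lt_trichotomy (pseudoweight a) (k * n / 2) with hw | hw | hw
    · exact Or.inl (hX.mem_of_low hw)
    · rcases hxor _ (circuit_mem_nonNegaCircuits.2 ⟨hw, hN⟩) with h' | h'
      · exact Or.inl ((h a).2 (Or.inr h'.1))
      · rw [reverseComplement_circuit] at h'
        exact Or.inr (hmem ((h _).2 (Or.inr h'.1)))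
    · refine Or.inr (hmem (hX.mem_of_low ?_))
      rw [pseudoweight_neg_reverse]; linarith
  have hd1 : Disjoint X ((fun a => -reverse a) '' X) := by
    rw [Set.disjoint_left]
    rintro _ ha ⟨b, hb, rfl⟩
    exact hX.ne_neg_reverse _ ha b hb rfl
  have hd : ∀ a ∈ X, a ∉ negaTuples k n := by
    intro a ha hN
    obtain ⟨S, hS, -, h⟩ := hX.exists_mem_iff
    have hm := mem_midEdges_of_mem_negaTuples hN
    rcases (h a).1 ha with h1 | h1
    · exact h1.ne hm
    · exact (circuit_mem_nonNegaCircuits.1 (hS h1)).2 hN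
  have hd2 : Disjoint (X ∪ (fun a => -reverse a) '' X) (negaTuples k n) := by
    rw [Set.disjoint_left]
    rintro a (ha | ⟨b, hb, rfl⟩) hN
    · exact hd a ha hN
    · exact hd b hb (neg_reverse_mem_negaTuples.1 hN)
  have := congrArg Set.ncard hcover
  rw [Set.ncard_union_eq hd2, Set.ncard_union_eq hd1,
    Set.ncard_image_of_injective _ neg_reverse_injective, Set.ncard_univ] at this
  rw [two_mul, this]
  simp [Nat.card_eq_fintype_card, ZMod.card]

end Extensions

/-! ### Unit-closed sets of prescribed approximate size -/

section Intermediate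

theorem ncard_circuit_le (a : Tuple k n) (hn : 0 < n) : (circuit a).ncard ≤ n := by
  have : circuit a = cyclicShift a '' Set.Iio n := by
    refine Set.Subset.antisymm ?_ (Set.image_subset_range _ _)
    rintro _ ⟨c, rfl⟩
    refine ⟨c % n, Nat.mod_lt _ hn, ?_⟩
    funext i
    rw [cyclicShift_apply, cyclicShift_apply]
    simp
  rw [this]
  refine (Set.ncard_image_le (Set.finite_Iio n)).trans ?_
  rw [← Finset.coe_Iio, Set.ncard_coe_finset, Nat.card_Iio]

/-- Between two closed sets of edges there are closed sets of edges of nearly every size. -/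
theorem exists_isUnitClosed_between [NeZero k] (hn : 0 < n) {K X : Set (Tuple k n)}
    (hK : IsUnitClosed K) (hX : IsUnitClosed X) (hKX : K ⊆ X) {T : ℕ} (hKT : K.ncard ≤ T)
    (hTX : T ≤ X.ncard) :
    ∃ Y, IsUnitClosed Y ∧ K ⊆ Y ∧ Y ⊆ X ∧ T ≤ Y.ncard ∧ Y.ncard < T + n := by
  classical
  obtain ⟨Y, ⟨hY, hKY, hYX, hTY⟩, hmin⟩ := Set.exists_min_image
    {Y : Set (Tuple k n) | IsUnitClosed Y ∧ K ⊆ Y ∧ Y ⊆ X ∧ T ≤ Y.ncard} Set.ncard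
    (Set.toFinite _) ⟨X, hX, hKX, subset_rfl, hTX⟩
  refine ⟨Y, hY, hKY, hYX, hTY, ?_⟩
  by_contra! hlt
  have hne : (Y \ K).Nonempty := by
    rw [Set.nonempty_iff_ne_empty]
    intro h
    have := Set.ncard_le_ncard (Set.sdiff_eq_empty.1 h)
    omega
  -- A tuple of `Y \ K` with the most entries other than `1` cannot arise from another tuple outside
  -- its circuit by setting an entry to `1`. Its circuit, of at most `n` tuples, can be removed,
  -- against minimality of `Y`.
  obtain ⟨a, ⟨haY, haK⟩, hmax⟩ := Set.exists_max_image (Y \ K)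
    (fun a => (Finset.univ.filter fun i => a i ≠ 1).card) (Set.toFinite _) hne
  have hcard : ∀ b ∈ circuit a, (Finset.univ.filter fun i => b i ≠ 1).card =
      (Finset.univ.filter fun i => a i ≠ 1).card := by
    rintro _ ⟨c, rfl⟩
    refine Finset.card_equiv (finRotate n ^ c) fun i => ?_
    rw [Finset.mem_filter, Finset.mem_filter]
    exact and_congr (by simp) Iff.rfl
  have hsub : circuit a ⊆ Y := by
    rintro _ ⟨c, rfl⟩
    exact hY.shift a haY c
  have hY' : IsUnitClosed (Y \ circuit a) := by
    refine ⟨fun b hb c => ⟨hY.shift b hb.1 c, fun h => hb.2 ?_⟩,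
      fun b hb i => ⟨hY.update b hb.1 i, fun h => ?_⟩⟩
    · rw [← circuit_eq_iff, circuit_cyclicShift] at h
      exact circuit_eq_iff.1 h
    · have hi : b i ≠ 1 := fun hi => hb.2 (by rwa [← hi, Function.update_eq_self] at h)
      have hbK : b ∉ K := fun hbK => haK (by
        obtain ⟨c, hc⟩ := mem_circuit_comm.1 h
        exact hc ▸ hK.shift _ (hK.update b hbK i) c)
      have h1 := hmax b ⟨hb.1, hbK⟩
      rw [← hcard _ h] at h1
      refine absurd h1 (not_le.2 (Finset.card_lt_card ?_))
      refine (Finset.ssubset_iff_of_subset fun j hj => ?_).2 ⟨i, by simpa using hi, by simp⟩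
      simp only [Finset.mem_filter, Finset.mem_univ, true_and] at hj ⊢
      intro hbj
      rw [Function.update_apply] at hj
      split_ifs at hj <;> contradiction
  have hsum := Set.ncard_sdiff_add_ncard_of_subset hsub
  have hle := ncard_circuit_le a hn
  have hpos : 0 < (circuit a).ncard := (Set.ncard_pos (Set.toFinite _)).2 ⟨a, mem_circuit_self a⟩
  have := hmin (Y \ circuit a) ⟨hY', fun b hb => ⟨hKY hb, fun h => haK (by
    obtain ⟨c, hc⟩ := mem_circuit_comm.1 h
    exact hc ▸ hK.shift b hb c)⟩, Set.sdiff_subset.trans hYX, by omega⟩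
  omega

end Intermediate

/-! ### The protected core -/

section Core

/-- The nonzero tuples over `{0, 1}`, and the tuples with one entry `2`, at most one entry `0` and
all other entries `1`. -/
def coreTuples (k n : ℕ) : Set (Tuple k n) :=
  {a | a ≠ 0 ∧ ∀ i, a i = 0 ∨ a i = 1} ∪
    Set.range fun p : Fin n × Fin n => Function.update (Function.update 1 p.2 0) p.1 2

theorem isUnitClosed_coreTuples [Fact (2 < k)] : IsUnitClosed (coreTuples k n) := by
  have : Fact (1 < k) := ⟨by have := Fact.out (p := 2 < k); omega⟩
  constructor
  · rintro a (⟨h0, h⟩ | ⟨⟨i, j⟩, rfl⟩) c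
    · refine Or.inl ⟨fun h1 => h0 ?_, fun i => h _⟩
      funext i
      have := congrFun h1 ((finRotate n ^ c).symm i)
      simpa [cyclicShift] using this
    · refine Or.inr ⟨⟨(finRotate n ^ c).symm i, (finRotate n ^ c).symm j⟩, ?_⟩
      funext l
      simp only [cyclicShift, Function.update_apply, Equiv.eq_symm_apply, Pi.one_apply]
  · rintro a (⟨h0, h⟩ | ⟨⟨i, j⟩, rfl⟩) l
    · refine Or.inl ⟨fun h1 => ?_, fun m => ?_⟩
      · have := congrFun h1 l
        rw [Function.update_self] at this
        exact one_ne_zero this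
      · rw [Function.update_apply]
        split_ifs
        · exact Or.inr rfl
        · exact h m
    · rcases eq_or_ne l i with rfl | hli
      · refine Or.inl ⟨fun h1 => ?_, fun m => ?_⟩
        · have := congrFun h1 l
          rw [Function.update_self] at this
          exact one_ne_zero this
        · simp only [Function.update_apply, Pi.one_apply]
          split_ifs <;> simp
      · rcases eq_or_ne l j with rfl | hlj
        · refine Or.inr ⟨⟨i, i⟩, ?_⟩
          funext m
          simp only [Function.update_apply, Pi.one_apply]
          split_ifs <;> simp_all
        · refine Or.inr ⟨⟨i, j⟩, ?_⟩
          funext m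
          simp only [Function.update_apply, Pi.one_apply]
          split_ifs <;> simp_all

theorem ncard_coreTuples_le [NeZero k] : (coreTuples k n).ncard ≤ 2 ^ n + n ^ 2 := by
  classical
  refine (Set.ncard_union_le _ _).trans (add_le_add ?_ ?_)
  · have hsub : {a : Tuple k n | a ≠ 0 ∧ ∀ i, a i = 0 ∨ a i = 1} ⊆
        (Fintype.piFinset fun _ : Fin n => ({0, 1} : Finset (ZMod k)) : Finset (Tuple k n)) := by
      intro a ha
      simpa using ha.2
    refine (Set.ncard_le_ncard hsub).trans ?_
    rw [Set.ncard_coe_finset, Fintype.card_piFinset, Finset.prod_const, Finset.card_univ,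
      Fintype.card_fin]
    exact Nat.pow_le_pow_left Finset.card_le_two n
  · rw [← Set.image_univ]
    refine (Set.ncard_image_le Set.finite_univ).trans ?_
    rw [Set.ncard_univ, Nat.card_eq_fintype_card, Fintype.card_prod, Fintype.card_fin, sq]

theorem coreTuples_subset [Fact (2 < k)] (hn : 4 ≤ n) {X : Set (Tuple k n)}
    (hX : IsExtension k n X) : coreTuples k n ⊆ X := by
  have hk := Fact.out (p := 2 < k)
  have : Fact (1 < k) := ⟨by omega⟩
  have hkQ : (3 : ℚ) ≤ k := by exact_mod_cast hk
  have hnQ : (4 : ℚ) ≤ n := by exact_mod_cast hn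
  have hw0 : entryWeight (0 : ZMod k) = k / 2 := if_pos rfl
  have hw1 : entryWeight (1 : ZMod k) = 1 := entryWeight_one
  have hw2 : entryWeight (2 : ZMod k) = 2 := by
    have hv : (2 : ZMod k).val = 2 := ZMod.val_cast_of_lt (n := k) (a := 2) hk
    unfold entryWeight
    rw [if_neg, hv]
    · norm_num
    · intro h
      rw [h, ZMod.val_zero] at hv
      exact absurd hv (by norm_num)
  rintro a (⟨h0, h⟩ | ⟨⟨i, j⟩, rfl⟩)
  · refine hX.mem_of_low ?_
    obtain ⟨i, hi⟩ := Function.ne_iff.1 h0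
    have hlt : ∑ i, entryWeight (a i) < ∑ _i : Fin n, (k : ℚ) / 2 := by
      refine Finset.sum_lt_sum (fun j _ => ?_) ⟨i, Finset.mem_univ _, ?_⟩
      · rcases h j with h | h <;> rw [h]
        · exact hw0.le
        · rw [hw1]; linarith
      · rw [(h i).resolve_left hi, hw1]; linarith
    rw [pseudoweight_eq_sum]
    refine hlt.trans_eq ?_
    simp; ring
  -- The weight is at most `n + k / 2`. This is below `k * n / 2` for `n ≥ 4`, but not for `n = k =
  -- 3`.
  · refine hX.mem_of_low ?_
    have hone : pseudoweight (1 : Tuple k n) = n := by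
      simp [pseudoweight_eq_sum, hw1]
    have hi : 1 ≤ entryWeight (Function.update (1 : Tuple k n) j 0 i) := by
      rw [Function.update_apply]
      split_ifs
      · rw [hw0]; linarith
      · exact hw1.ge
    rw [pseudoweight_update, pseudoweight_update, hone, hw2, hw0, Pi.one_apply, hw1]
    nlinarith

end Core

/-- If `t < n`, then `X` is already within `n` of the target and need not be shrunk; otherwise the
core must fit below the target size. -/
theorem exists_orientable_of_ncard [Fact (2 < k)] (hn : 4 ≤ n) {X : Set (Tuple k n)}
    (hX : IsExtension k n X) {t : ℕ} (htX : t < X.ncard)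
    (ht : t < n ∨ 2 ^ n + n ^ 2 + t ≤ X.ncard) :
    ∃ s : ℕ → ZMod k, IsOrientableSequence (n + 1) s (k * (X.ncard - t)) := by
  have : NeZero k := ⟨by have := Fact.out (p := 2 < k); omega⟩
  obtain ⟨Y, hY, hKY, hYX, h1, h2⟩ : ∃ Y, IsUnitClosed Y ∧ coreTuples k n ⊆ Y ∧ Y ⊆ X ∧
      X.ncard - t ≤ Y.ncard ∧ Y.ncard < X.ncard - t + n := by
    rcases ht with ht | ht
    · exact ⟨X, hX.isUnitClosed, coreTuples_subset hn hX, subset_rfl, by omega, by omega⟩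
    · refine exists_isUnitClosed_between (by omega) isUnitClosed_coreTuples hX.isUnitClosed
        (coreTuples_subset hn hX) ?_ (by omega)
      exact ncard_coreTuples_le.trans (by omega)
  obtain ⟨Z, hZY, hcard, hbal, hconn⟩ := exists_connected_subset
    (r := Y.ncard - (X.ncard - t)) hn hY (fun a h h' => hKY (Or.inl ⟨h, h'⟩))
    (fun i j => hKY (Or.inr ⟨⟨i, j⟩, rfl⟩)) (by omega)
  have hZ : Z.ncard = X.ncard - t := by omega
  obtain ⟨s, -, hs⟩ := exists_eulerian_orientable
    ((Set.ncard_pos (Set.toFinite Z)).1 (by omega)) hbal hconn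
    fun a ha b hb => hX.ne_neg_reverse a (hYX (hZY ha)) b (hYX (hZY hb))
  exact ⟨s, hZ ▸ hs⟩

theorem IsExtension.exists_eulerian_orientable [Fact (2 < k)] (hn : 2 ≤ n)
    {X : Set (Tuple k n)} (hX : IsExtension k n X) :
    ∃ s : ℕ → ZMod k, IsEulerianCircuit (lempel ⁻¹' X) (k * X.ncard) (window s (n + 1)) ∧
      IsOrientableSequence (n + 1) s (k * X.ncard) := by
  have hk := Fact.out (p := 2 < k)
  have : NeZero k := ⟨by omega⟩
  have hY := hX.isUnitClosed
  have hne : (1 : Tuple k n) ∈ X := hX.mem_of_low (by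
    have hkQ : (3 : ℚ) ≤ k := by exact_mod_cast hk
    have hnQ : (2 : ℚ) ≤ n := by exact_mod_cast hn
    simp only [pseudoweight_eq_sum, Pi.one_apply, entryWeight_one]
    simp
    nlinarith)
  exact OrientableSeq.exists_eulerian_orientable ⟨_, hne⟩ (hY.liftBalanced (by omega))
    hY.liftConnected hX.ne_neg_reverse

/-! ### A lower bound for the size of an extension -/

section Sizes

/-- The only coincidence of weights is between `0` and the residue `k / 2`, which exists only for
even `k`. -/
theorem card_entryWeight_fiber_le [NeZero k] (w : ℚ) :
    {x : ZMod k | entryWeight x = w}.ncard ≤ delta k := by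
  have hinj : ∀ x y : ZMod k, x ≠ 0 → y ≠ 0 → entryWeight x = entryWeight y → x = y := by
    intro x y hx hy h
    rw [entryWeight, entryWeight, if_neg hx, if_neg hy] at h
    exact ZMod.val_injective k (by exact_mod_cast h)
  unfold delta
  split_ifs with hk
  · have hsub : {x : ZMod k | entryWeight x = w} ⊆
        {0} ∪ {x | x ≠ 0 ∧ entryWeight x = w} := by
      intro x hx
      by_cases h : x = 0
      · exact Or.inl h
      · exact Or.inr ⟨h, hx⟩
    refine (Set.ncard_le_ncard hsub).trans ((Set.ncard_union_le _ _).trans ?_)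
    rw [Set.ncard_singleton]
    have : {x : ZMod k | x ≠ 0 ∧ entryWeight x = w}.ncard ≤ 1 :=
      (Set.ncard_le_one (Set.toFinite _)).2 fun x hx y hy => hinj x y hx.1 hy.1 (hx.2.trans hy.2.symm)
    omega
  · have h0 : ∀ x : ZMod k, x ≠ 0 → entryWeight (0 : ZMod k) ≠ entryWeight x := by
      intro x hx h
      rw [entryWeight, entryWeight, if_pos rfl, if_neg hx, div_eq_iff two_ne_zero] at h
      exact hk ⟨x.val, by rw [← mul_two]; exact_mod_cast h⟩
    refine (Set.ncard_le_one (Set.toFinite _)).2 fun x hx y hy => ?_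
    have hxy : entryWeight x = entryWeight y := Eq.trans hx (Eq.symm hy)
    by_cases h1 : x = 0 <;> by_cases h2 : y = 0
    · rw [h1, h2]
    · subst h1; exact absurd hxy (h0 _ h2)
    · subst h2; exact absurd hxy.symm (h0 _ h1)
    · exact hinj x y h1 h2 hxy

/-- The last `n` entries prescribe the weight of the first, leaving at most `delta k` choices. -/
theorem ncard_midEdges_le [NeZero k] : (midEdges k (n + 1)).ncard ≤ delta k * k ^ n := by
  classical
  rw [Set.ncard_eq_toFinset_card']
  refine (Finset.card_le_mul_card_image (f := fun a : Tuple k (n + 1) => Fin.tail a) _ (delta k)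
    ?_).trans ?_
  · intro v _
    refine le_trans ?_ (card_entryWeight_fiber_le
      ((k : ℚ) * (n + 1 : ℕ) / 2 - pseudoweight v))
    rw [← Set.ncard_coe_finset]
    refine Set.ncard_le_ncard_of_injOn (fun a => a 0) ?_ ?_
    · intro a ha
      simp only [Finset.coe_filter, Set.mem_toFinset, Set.mem_ofPred_eq] at ha
      have h1 : pseudoweight a = (k : ℚ) * (n + 1 : ℕ) / 2 := ha.1
      rw [pseudoweight_eq_sum, Fin.sum_univ_succ] at h1
      change entryWeight (a 0) = _
      rw [← h1, ← ha.2]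
      simp [pseudoweight_eq_sum, Fin.tail]
    · intro a ha b hb hab
      simp only [Finset.coe_filter, Set.mem_toFinset, Set.mem_ofPred_eq] at ha hb
      rw [← Fin.cons_self_tail a, ← Fin.cons_self_tail b, ha.2, hb.2]
      simp only at hab
      rw [hab]
  · refine Nat.mul_le_mul_left _ ((Finset.card_le_univ _).trans ?_)
    simp [ZMod.card]

theorem two_mul_delta_le (hk : 3 ≤ k) : 2 * delta k ≤ k := by
  unfold delta
  split_ifs with h
  · obtain ⟨m, rfl⟩ := h; omega
  · omega

/-- Tuples on negasymmetric circuits have weight exactly half the maximum `k * n` allowed by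
symmetry, so they number at most `delta k * k ^ (n - 1)`, hence at most half of all tuples. -/
theorem IsExtension.pow_le_four_mul_ncard (hk : 3 ≤ k) (hn : 0 < n) {X : Set (Tuple k n)}
    (hX : IsExtension k n X) : k ^ n ≤ 4 * X.ncard := by
  have : NeZero k := ⟨by omega⟩
  obtain ⟨m, rfl⟩ : ∃ m, n = m + 1 := ⟨n - 1, by omega⟩
  have h1 := hX.two_mul_ncard_add
  have h2 : (negaTuples k (m + 1)).ncard ≤ delta k * k ^ m :=
    (Set.ncard_le_ncard fun a => mem_midEdges_of_mem_negaTuples).trans ncard_midEdges_le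
  have h4 := Nat.mul_le_mul_right (k ^ m) (two_mul_delta_le hk)
  have h5 : k ^ (m + 1) = k * k ^ m := pow_succ' k m
  rw [mul_assoc] at h4
  omega

end Sizes

/-! ### Numerical estimates -/

section Arithmetic

theorem two_mul_geom_le (hk : 3 ≤ k) (h : ℕ) :
    2 * ∑ d ∈ Finset.Icc 2 h, (k ^ d - k) ≤ k ^ (h + 1) := by
  induction h with
  | zero => simp
  | succ h ih =>
    rcases Nat.lt_or_ge (h + 1) 2 with h1 | h1
    · rw [Finset.Icc_eq_empty (by omega)]; simp
    · rw [Finset.sum_Icc_succ_top h1, mul_add]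
      have h2 : k ^ (h + 1 + 1) = k * k ^ (h + 1) := pow_succ' k _
      have h3 : 3 * k ^ (h + 1) ≤ k * k ^ (h + 1) := Nat.mul_le_mul_right _ hk
      omega

theorem four_mul_le_three_pow {j : ℕ} (hj : 2 ≤ j) : 4 * j ≤ 3 ^ j := by
  induction j, hj using Nat.le_induction with
  | base => norm_num
  | succ j hj ih => rw [pow_succ]; omega

theorem two_pow_le_three_pow (hn : 6 ≤ n) : 32 * 2 ^ n ≤ 3 * 3 ^ n := by
  induction n, hn using Nat.le_induction with
  | base => norm_num
  | succ n hn ih => rw [pow_succ, pow_succ]; omega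

theorem sq_le_three_pow (hn : 6 ≤ n) : 32 * n ^ 2 ≤ 3 * 3 ^ n := by
  induction n, hn using Nat.le_induction with
  | base => norm_num
  | succ n hn ih =>
    rw [pow_succ 3 n]
    nlinarith

/-- For `n ≥ 6` the geometric sum gives `t ≤ k ^ n / 16`, while `2 ^ n` and `n ^ 2` are each at most
`3 * k ^ n / 32`; together these make `k ^ n / 4`. The cases `n = 4, 5` are checked directly, and `k
= 3` is where only `t < n` is shown. -/
theorem lt_or_core_le (hk : 3 ≤ k) (hn : 4 ≤ n) {t x : ℕ} (hx : k ^ n ≤ 4 * x)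
    (ht : 4 * t ≤ (n - 2) * ∑ d ∈ Finset.Icc 2 (n / 2), (k ^ d - k)) :
    t < n ∨ 2 ^ n + n ^ 2 + t ≤ x := by
  rcases Nat.lt_or_ge n 6 with h6 | h6
  · have h2 : ∑ d ∈ Finset.Icc 2 (n / 2), (k ^ d - k) = k ^ 2 - k := by
      rw [show n / 2 = 2 by omega]; simp
    rw [h2] at ht
    rcases hk.eq_or_lt with rfl | hk4
    · left
      interval_cases n <;> omega
    · right
      have h3 : 16 ≤ k ^ 2 := by nlinarith
      interval_cases n
      · have : k ^ 4 = k ^ 2 * k ^ 2 := by ring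
        have : 16 * k ^ 2 ≤ k ^ 2 * k ^ 2 := Nat.mul_le_mul_right _ h3
        omega
      · have h5 : k ^ 5 = k * (k ^ 2 * k ^ 2) := by ring
        have : 16 * k ^ 2 ≤ k ^ 2 * k ^ 2 := Nat.mul_le_mul_right _ h3
        have : 4 * (k ^ 2 * k ^ 2) ≤ k * (k ^ 2 * k ^ 2) := Nat.mul_le_mul_right _ hk4
        omega
  · right
    have hg := two_mul_geom_le hk (n / 2)
    obtain ⟨j, hj⟩ : ∃ j, n = n / 2 + 1 + j := ⟨n - n / 2 - 1, by omega⟩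
    have hj2 : 2 ≤ j := by omega
    have h1 : 8 * t ≤ (n - 2) * k ^ (n / 2 + 1) := by
      have := Nat.mul_le_mul_left (n - 2) hg
      rw [← mul_assoc, mul_comm (n - 2) 2, mul_assoc] at this
      omega
    have h2 : 2 * ((n - 2) * k ^ (n / 2 + 1)) ≤ k ^ n := by
      have h3 : 2 * (n - 2) ≤ k ^ j :=
        le_trans (by omega) ((four_mul_le_three_pow hj2).trans (Nat.pow_le_pow_left hk j))
      calc 2 * ((n - 2) * k ^ (n / 2 + 1)) = 2 * (n - 2) * k ^ (n / 2 + 1) := by ring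
        _ ≤ k ^ j * k ^ (n / 2 + 1) := Nat.mul_le_mul_right _ h3
        _ = k ^ n := by rw [← pow_add]; congr 1; omega
    have h4 : 3 ^ n ≤ k ^ n := Nat.pow_le_pow_left hk n
    have h5 := two_pow_le_three_pow h6
    have h7 := sq_le_three_pow h6
    omega

end Arithmetic

/-! ### Lengths of circuits -/

section CircuitSize

theorem iterate_cyclicShift_one (a : Tuple k n) (c : ℕ) :
    (fun b : Tuple k n => cyclicShift b 1)^[c] a = cyclicShift a c := by
  induction c with
  | zero => simp
  | succ c ih => rw [Function.iterate_succ_apply', ih, cyclicShift_cyclicShift]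

/-- The least period of a tuple under cyclic shifts. -/
noncomputable def shiftPeriod (a : Tuple k n) : ℕ :=
  Function.minimalPeriod (fun b : Tuple k n => cyclicShift b 1) a

theorem isPeriodicPt_cyclicShift (a : Tuple k n) :
    Function.IsPeriodicPt (fun b : Tuple k n => cyclicShift b 1) n a := by
  rw [Function.IsPeriodicPt, Function.IsFixedPt, iterate_cyclicShift_one, cyclicShift_self]

theorem shiftPeriod_dvd (a : Tuple k n) : shiftPeriod a ∣ n :=
  (isPeriodicPt_cyclicShift a).minimalPeriod_dvd

theorem shiftPeriod_pos (hn : 0 < n) (a : Tuple k n) : 0 < shiftPeriod a :=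
  (isPeriodicPt_cyclicShift a).minimalPeriod_pos hn

theorem cyclicShift_eq_cyclicShift_iff (hn : 0 < n) (a : Tuple k n) (i j : ℕ) :
    cyclicShift a i = cyclicShift a j ↔ i ≡ j [MOD shiftPeriod a] := by
  rw [← iterate_cyclicShift_one, ← iterate_cyclicShift_one]
  exact iterate_eq_iterate_iff_modEq (Function.mk_mem_periodicPts hn (isPeriodicPt_cyclicShift a))
    i j

theorem circuit_eq_range_iterate (a : Tuple k n) :
    circuit a = Set.range fun i => (fun b : Tuple k n => cyclicShift b 1)^[i] a := by
  simp only [iterate_cyclicShift_one]; rfl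

theorem ncard_circuit (hn : 0 < n) (a : Tuple k n) : (circuit a).ncard = shiftPeriod a := by
  rw [circuit_eq_range_iterate]
  exact ncard_range_iterate (Function.mk_mem_periodicPts hn (isPeriodicPt_cyclicShift a))

theorem cyclicShift_shiftPeriod (hn : 0 < n) (a : Tuple k n) :
    cyclicShift a (shiftPeriod a) = a := by
  conv_rhs => rw [← cyclicShift_zero a]
  rw [cyclicShift_eq_cyclicShift_iff hn]
  exact (Nat.modEq_zero_iff_dvd).2 dvd_rfl

theorem apply_eq_apply_of_modEq {a : Tuple k n} {d : ℕ} (hd : cyclicShift a d = a) (i : ℕ)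
    (hi : i < n) (hm : i % d < n) : a ⟨i, hi⟩ = a ⟨i % d, hm⟩ := by
  induction i using Nat.strong_induction_on with
  | _ i ih =>
    rcases Nat.lt_or_ge i d with h | h
    · simp only [Nat.mod_eq_of_lt h]
    · rcases Nat.eq_zero_or_pos d with rfl | hd0
      · simp only [Nat.mod_zero]
      · have h1 := congrFun hd ⟨i - d, by omega⟩
        rw [cyclicShift_apply] at h1
        simp only [Nat.sub_add_cancel h, Nat.mod_eq_of_lt hi] at h1
        have h2 : (i - d) % d = i % d := by rw [← Nat.mod_eq_sub_mod h]
        rw [h1, ih (i - d) (by omega) (by omega) (by rw [h2]; exact hm)]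
        simp only [h2]

theorem ncard_shiftPeriod_eq_le [NeZero k] (d : ℕ) (hd : 2 ≤ d) (hdn : d ≤ n) :
    {a : Tuple k n | shiftPeriod a = d}.ncard ≤ k ^ d - k := by
  have hn : 0 < n := by omega
  let f : Tuple k n → Tuple k d := fun a i => a (Fin.castLE hdn i)
  have hdet : ∀ a : Tuple k n, shiftPeriod a = d → ∀ i : Fin n,
      a i = f a ⟨i % d, Nat.mod_lt _ (by omega)⟩ := by
    intro a ha i
    have h := cyclicShift_shiftPeriod hn a
    rw [ha] at h
    exact apply_eq_apply_of_modEq h i i.2 ((Nat.mod_le _ _).trans_lt i.2)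
  have hconst : (Set.range fun x : ZMod k => (fun _ => x : Tuple k d)).ncard = k := by
    rw [← Set.image_univ, Set.ncard_image_of_injective, Set.ncard_univ, Nat.card_zmod]
    intro x y h
    exact congrFun h ⟨0, by omega⟩
  have huniv : (Set.univ : Set (Tuple k d)).ncard = k ^ d := by
    rw [Set.ncard_univ]; simp [Nat.card_eq_fintype_card, ZMod.card]
  have : (Set.univ \ Set.range fun x : ZMod k => (fun _ => x : Tuple k d)).ncard = k ^ d - k := by
    rw [Set.ncard_sdiff (Set.subset_univ _), hconst, huniv]
  rw [← this]
  refine Set.ncard_le_ncard_of_injOn f (fun a ha => ⟨trivial, ?_⟩) (fun a ha b hb hab => ?_)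
  -- A constant prefix of length `d` would make the tuple constant, of period `1 < d`.
  · rintro ⟨x, hx⟩
    have hx' : ∀ i, a i = x := fun i => by rw [hdet a ha i, ← hx]
    have h1 : cyclicShift a 1 = cyclicShift a 0 := by
      funext i; rw [cyclicShift_apply, cyclicShift_apply, hx', hx']
    rw [cyclicShift_eq_cyclicShift_iff hn, show shiftPeriod a = d from ha,
      Nat.modEq_zero_iff_dvd] at h1
    have := Nat.le_of_dvd one_pos h1
    omega
  · funext i
    rw [hdet a ha i, hdet b hb i, hab]

theorem ncard_eq_sum_circuits [NeZero k] (A : Set (Tuple k n)) (hA : ∀ a ∈ A, circuit a ⊆ A)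
    (𝒞 : Finset (Set (Tuple k n))) (h𝒞 : ∀ C, C ∈ 𝒞 ↔ ∃ a ∈ A, C = circuit a) :
    A.ncard = ∑ C ∈ 𝒞, C.ncard := by
  classical
  rw [Set.ncard_eq_toFinset_card', Finset.card_eq_sum_card_fiberwise (f := circuit) (t := 𝒞)]
  · refine Finset.sum_congr rfl fun C hC => ?_
    obtain ⟨a, ha, rfl⟩ := (h𝒞 C).1 hC
    rw [← Set.ncard_coe_finset]
    congr 1
    ext b
    simp only [Finset.coe_filter, Set.mem_toFinset, Set.mem_ofPred_eq, circuit_eq_iff]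
    exact ⟨fun h => h.2, fun h => ⟨hA a ha h, h⟩⟩
  · intro a ha
    exact (h𝒞 _).2 ⟨a, by simpa using ha, rfl⟩

end CircuitSize

/-! ### Negasymmetric tuples on a circuit -/

section Negasymmetric

theorem card_two_mul_modEq_odd {d : ℕ} (hd : Odd d) (e : ℕ) :
    {c | c < d ∧ 2 * c ≡ e [MOD d]}.ncard = 1 := by
  have hpos : 0 < d := hd.pos
  rw [Set.ncard_eq_one]
  refine ⟨(e * ((d + 1) / 2)) % d, ?_⟩
  have h0 : 2 * ((e * ((d + 1) / 2)) % d) ≡ e [MOD d] := by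
    refine ((Nat.mod_modEq _ _).mul_left 2).trans ?_
    obtain ⟨m, rfl⟩ := hd
    rw [show (2 * m + 1 + 1) / 2 = m + 1 by omega,
      show 2 * (e * (m + 1)) = e + e * (2 * m + 1) by ring]
    simp [Nat.ModEq]
  ext c
  constructor
  · rintro ⟨hc, h⟩
    refine Nat.ModEq.eq_of_lt_of_lt ?_ hc (Nat.mod_lt _ hpos)
    exact Nat.ModEq.cancel_left_of_coprime (by rw [Nat.Coprime.gcd_eq_one hd.coprime_two_right])
      (h.trans h0.symm)
  · rintro rfl
    exact ⟨Nat.mod_lt _ hpos, h0⟩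

theorem card_two_mul_modEq_even {d : ℕ} (hd : Even d) (hpos : 0 < d) (e : ℕ) :
    {c | c < d ∧ 2 * c ≡ e [MOD d]}.ncard = 0 ∨ {c | c < d ∧ 2 * c ≡ e [MOD d]}.ncard = 2 := by
  obtain ⟨h, rfl⟩ := hd
  rw [← two_mul] at *
  have hh : 0 < h := by omega
  rcases Nat.even_or_odd' e with ⟨f, rfl | rfl⟩
  · right
    rw [Set.ncard_eq_two]
    refine ⟨f % h, f % h + h, by omega, ?_⟩
    ext c
    have hlt := Nat.mod_lt f hh
    simp only [Set.mem_ofPred_eq, Set.mem_insert_iff, Set.mem_singleton_iff,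
      Nat.ModEq.mul_left_cancel_iff' two_ne_zero]
    constructor
    · rintro ⟨hc, hm⟩
      have hm' : f % h = c % h := hm.symm
      rcases Nat.lt_or_ge c h with h1 | h1
      · left; rw [hm', Nat.mod_eq_of_lt h1]
      · right
        have : c % h = c - h := by rw [Nat.mod_eq_sub_mod h1, Nat.mod_eq_of_lt (by omega)]
        rw [hm', this]; omega
    · rintro (rfl | rfl)
      · exact ⟨by omega, Nat.mod_modEq _ _⟩
      · exact ⟨by omega, by simp [Nat.ModEq]⟩
  · left
    rw [Set.ncard_eq_zero (Set.Finite.subset (Set.finite_Iio (2 * h)) fun c hc => hc.1)]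
    ext c
    simp only [Set.mem_ofPred_eq, Set.mem_empty_iff_false, iff_false, not_and]
    intro _ hm
    have := (hm.of_dvd (Dvd.intro h rfl) : 2 * c ≡ 2 * f + 1 [MOD 2])
    simp only [Nat.ModEq] at this
    omega

/-- The negasymmetric tuples on a circuit correspond to the solutions of a congruence. -/
theorem ncard_isNegasymmetric_circuit (hn : 0 < n) {a : Tuple k n} {e : ℕ}
    (he : -reverse a = cyclicShift a e) :
    {b ∈ circuit a | IsNegasymmetric b}.ncard =
      {c | c < shiftPeriod a ∧ 2 * c ≡ e [MOD shiftPeriod a]}.ncard := by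
  -- With `-a^R` the shift of `a` by `e`, the shift of `a` by `c` is mapped to the shift by `e - c`.
  have hiff : ∀ c, IsNegasymmetric (cyclicShift a c) ↔ 2 * c ≡ e [MOD shiftPeriod a] := by
    intro c
    rw [IsNegasymmetric, neg_reverse_cyclicShift, he, cyclicShift_cyclicShift,
      cyclicShift_eq_cyclicShift_iff hn]
    have h1 : e + c * (n - 1) + c ≡ e [MOD shiftPeriod a] := by
      rw [show e + c * (n - 1) + c = e + c * n by
        obtain ⟨m, rfl⟩ := Nat.exists_eq_succ_of_ne_zero hn.ne'
        simp; ring]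
      exact (((Nat.modEq_zero_iff_dvd).2 ((shiftPeriod_dvd a).mul_left c)).add_left e)
    constructor
    · intro h
      rw [two_mul]
      exact (h.add_right c).trans h1
    · intro h
      rw [two_mul] at h
      exact Nat.ModEq.add_right_cancel' c (h.trans h1.symm)
  have himg : {b ∈ circuit a | IsNegasymmetric b} =
      cyclicShift a '' {c | c < shiftPeriod a ∧ 2 * c ≡ e [MOD shiftPeriod a]} := by
    ext b
    constructor
    · rintro ⟨⟨c, rfl⟩, hb⟩
      refine ⟨c % shiftPeriod a, ⟨Nat.mod_lt _ (shiftPeriod_pos hn a), ?_⟩, ?_⟩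
      · exact ((Nat.mod_modEq c _).mul_left 2).trans ((hiff c).1 hb)
      · exact (cyclicShift_eq_cyclicShift_iff hn a _ _).2 (Nat.mod_modEq _ _)
    · rintro ⟨c, hc, rfl⟩
      exact ⟨cyclicShift_mem_circuit a c, (hiff c).2 hc.2⟩
  rw [himg, Set.InjOn.ncard_image]
  intro i hi j hj hij
  exact Nat.ModEq.eq_of_lt_of_lt ((cyclicShift_eq_cyclicShift_iff hn a i j).1 hij) hi.1 hj.1

/-- The negasymmetric circuits in `𝒞_k(n-1)`. -/
def allNegaCircuits (k n : ℕ) : Set (Set (Tuple k n)) :=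
  {C ∈ circuits k n | IsNegasymmetricCircuit C}

theorem mem_allNegaCircuits_iff [NeZero k] {C : Set (Tuple k n)} :
    C ∈ allNegaCircuits k n ↔ ∃ a ∈ negaTuples k n, C = circuit a := by
  constructor
  · rintro ⟨⟨a, ha, rfl⟩, h⟩
    exact ⟨a, isNegasymmetricCircuit_circuit.1 h, rfl⟩
  · rintro ⟨a, ha, rfl⟩
    exact ⟨circuit_mem_circuits.2 (mem_midEdges_of_mem_negaTuples ha),
      isNegasymmetricCircuit_circuit.2 ha⟩

theorem ncard_negasymmetric_of_mem [NeZero k] (hn : 0 < n) {C : Set (Tuple k n)}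
    (hC : C ∈ allNegaCircuits k n) :
    (Odd C.ncard → {a ∈ C | IsNegasymmetric a}.ncard = 1) ∧
      (Even C.ncard → {a ∈ C | IsNegasymmetric a}.ncard = 0 ∨
        {a ∈ C | IsNegasymmetric a}.ncard = 2) := by
  obtain ⟨a, ⟨e, he⟩, rfl⟩ := mem_allNegaCircuits_iff.1 hC
  rw [ncard_circuit hn, ncard_isNegasymmetric_circuit hn he.symm]
  exact ⟨fun h => card_two_mul_modEq_odd h e,
    fun h => card_two_mul_modEq_even h (shiftPeriod_pos hn a) e⟩

/-- The congruence `2c ≡ e` has one solution for an odd modulus, and none or two for an even one, so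
the classes `N_i` only record the parity of the length. -/
theorem negaCircuits_one_eq [NeZero k] (hn : 0 < n) :
    negaCircuits 1 n k = {C ∈ allNegaCircuits k n | Odd C.ncard} := by
  ext C
  constructor
  · rintro ⟨h1, h2, h3⟩
    refine ⟨⟨h1, h2⟩, Nat.not_even_iff_odd.1 fun h => ?_⟩
    rcases (ncard_negasymmetric_of_mem hn (C := C) ⟨h1, h2⟩).2 h with h | h <;> omega
  · rintro ⟨h, ho⟩
    exact ⟨h.1, h.2, (ncard_negasymmetric_of_mem hn h).1 ho⟩

theorem negaCircuits_zero_union_two_eq [NeZero k] (hn : 0 < n) :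
    negaCircuits 0 n k ∪ negaCircuits 2 n k = {C ∈ allNegaCircuits k n | ¬ Odd C.ncard} := by
  ext C
  constructor
  · rintro (⟨h1, h2, h3⟩ | ⟨h1, h2, h3⟩) <;>
    · refine ⟨⟨h1, h2⟩, fun h => ?_⟩
      have := (ncard_negasymmetric_of_mem hn (C := C) ⟨h1, h2⟩).1 h
      omega
  · rintro ⟨h, ho⟩
    rcases (ncard_negasymmetric_of_mem hn h).2 (Nat.not_odd_iff_even.1 ho) with h' | h'
    · exact Or.inl ⟨h.1, h.2, h'⟩
    · exact Or.inr ⟨h.1, h.2, h'⟩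

theorem ncard_zero_add_two [NeZero k] (hn : 0 < n) :
    (negaCircuits 0 n k).ncard + (negaCircuits 2 n k).ncard =
      {C ∈ allNegaCircuits k n | ¬ Odd C.ncard}.ncard := by
  rw [← negaCircuits_zero_union_two_eq hn, Set.ncard_union_eq]
  rw [Set.disjoint_left]
  rintro C ⟨-, -, h⟩ ⟨-, -, h'⟩
  omega

theorem ncard_neg_eq_self [NeZero k] : {x : ZMod k | -x = x}.ncard = delta k := by
  unfold delta
  split_ifs with hk
  · obtain ⟨h, hh⟩ := hk
    have hk0 := NeZero.pos k
    rw [Set.ncard_eq_two]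
    have hv : ((h : ℕ) : ZMod k).val = h := ZMod.val_cast_of_lt (by omega)
    refine ⟨0, (h : ZMod k), fun h0 => ?_, ?_⟩
    · rw [← h0, ZMod.val_zero] at hv; omega
    · ext x
      simp only [Set.mem_ofPred_eq, ZMod.neg_eq_self_iff, Set.mem_insert_iff,
        Set.mem_singleton_iff]
      refine or_congr Iff.rfl ⟨fun hx => ?_, ?_⟩
      · apply ZMod.val_injective k
        rw [hv]; omega
      · rintro rfl
        rw [hv]; omega
  · rw [Set.ncard_eq_one]
    refine ⟨0, ?_⟩
    ext x
    simp only [Set.mem_ofPred_eq, ZMod.neg_eq_self_iff, Set.mem_singleton_iff, or_iff_left_iff_imp]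
    intro hx
    exact absurd ⟨x.val, by omega⟩ hk

theorem circuit_const (x : ZMod k) : circuit (fun _ => x : Tuple k n) = {fun _ => x} := by
  ext b
  constructor
  · rintro ⟨c, rfl⟩; rfl
  · rintro rfl; exact mem_circuit_self _

/-- Circuits of length `1` are the constant tuples `x` with `-x = x`; this is the origin of `δ`. -/
theorem ncard_allNegaCircuits_eq_one [NeZero k] (hn : 0 < n) :
    {C ∈ allNegaCircuits k n | C.ncard = 1}.ncard = delta k := by
  rw [← ncard_neg_eq_self, ← Set.ncard_image_of_injective {x : ZMod k | -x = x}
    (f := fun x => ({fun _ => x} : Set (Tuple k n)))]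
  · congr 1
    ext C
    constructor
    · rintro ⟨hC, h1⟩
      obtain ⟨a, ha, rfl⟩ := mem_allNegaCircuits_iff.1 hC
      obtain ⟨b, hb⟩ := Set.ncard_eq_one.1 h1
      have hall : ∀ c ∈ circuit a, c = a := by
        intro c hc
        have h2 := mem_circuit_self a
        rw [hb] at hc h2
        exact hc.trans h2.symm
      have ha' : ∀ i : Fin n, a i = a ⟨0, hn⟩ := by
        intro i
        have := congrFun (hall _ (cyclicShift_mem_circuit a i)) ⟨0, hn⟩
        rw [cyclicShift_apply] at this
        rw [← this]
        congr 1
        ext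
        simp [Nat.mod_eq_of_lt i.2]
      have hac : a = fun _ => a ⟨0, hn⟩ := funext ha'
      refine ⟨a ⟨0, hn⟩, ?_, ?_⟩
      · have := congrFun (hall _ ha) ⟨0, hn⟩
        rw [Pi.neg_apply, reverse, ha'] at this
        exact this
      · simp only
        rw [← hac, hac, circuit_const]
    · rintro ⟨x, hx, rfl⟩
      refine ⟨mem_allNegaCircuits_iff.2 ⟨fun _ => x, ?_, (circuit_const x).symm⟩,
        Set.ncard_singleton _⟩
      change -reverse (fun _ => x : Tuple k n) ∈ circuit _
      rw [circuit_const]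
      funext i
      exact hx
  · intro x y h
    exact congrFun (Set.singleton_injective h) ⟨0, hn⟩

end Negasymmetric

/-! ### Nominal against true length of a negasymmetric circuit -/

section Deficiency

/-- The size that `s_k(n-1)` attributes to a negasymmetric circuit with `d` edges. -/
def nominalSize (n d : ℕ) : ℕ := if d = 1 then 1 else if Odd d then oddPart n else n

theorem oddPart_eq (n : ℕ) : oddPart n = n / 2 ^ n.factorization 2 := by
  rw [oddPart, Nat.factorization_def _ Nat.prime_two]

theorem odd_oddPart (hn : n ≠ 0) : Odd (oddPart n) := by
  rw [oddPart_eq, ← Nat.not_even_iff_odd, even_iff_two_dvd]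
  exact Nat.not_dvd_ordCompl Nat.prime_two hn

theorem dvd_oddPart {d : ℕ} (hd : Odd d) (h : d ∣ n) : d ∣ oddPart n := by
  rw [oddPart_eq]
  refine Nat.Coprime.dvd_of_dvd_mul_left (hd.coprime_two_right.pow_right (n.factorization 2)) ?_
  rwa [Nat.ordProj_mul_ordCompl_eq_self]

theorem oddPart_le (n : ℕ) : oddPart n ≤ n := Nat.div_le_self _ _

theorem le_nominalSize {d : ℕ} (hn : 0 < n) (h : d ∣ n) : d ≤ nominalSize n d := by
  unfold nominalSize
  split_ifs with h1 h2
  · exact h1.le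
  · exact Nat.le_of_dvd (odd_oddPart hn.ne').pos (dvd_oddPart h2 h)
  · exact Nat.le_of_dvd hn h

theorem even_nominalSize_sub {d : ℕ} (hn : 0 < n) (h : d ∣ n) : Even (nominalSize n d - d) := by
  unfold nominalSize
  split_ifs with h1 h2
  · simp [h1]
  · exact Nat.Odd.sub_odd (odd_oddPart hn.ne') h2
  · rw [Nat.not_odd_iff_even] at h2
    exact (h2.trans_dvd h).tsub h2

/-- There is no deficiency for `d = 1` or `d = n`. Any other divisor satisfies `2 ≤ d ≤ n / 2`, and
then `2 * (n - d) ≤ (n - 2) * d`. -/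
theorem two_mul_nominalSize_sub_le {d : ℕ} (hn : 0 < n) (h : d ∣ n) :
    2 * (nominalSize n d - d) ≤ if 2 ≤ d ∧ d ≤ n / 2 then (n - 2) * d else 0 := by
  have hd0 : 0 < d := Nat.pos_of_dvd_of_pos h hn
  have hle : d ≠ 1 → nominalSize n d ≤ n := by
    intro h1
    unfold nominalSize
    rw [if_neg h1]
    split_ifs
    · exact oddPart_le n
    · exact le_rfl
  by_cases h1 : d = 1
  · simp [h1, nominalSize]
  have hle := hle h1
  obtain ⟨q, rfl⟩ := h
  rcases Nat.lt_or_ge q 2 with hq | hq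
  · have : q = 1 := by
      have : q ≠ 0 := by rintro rfl; simp at hn
      omega
    subst this
    rw [mul_one] at *
    rw [show nominalSize d d - d = 0 by omega]
    simp
  · have h2 : d ≤ d * q / 2 := by
      rw [Nat.le_div_iff_mul_le two_pos]
      exact Nat.mul_le_mul_left d hq
    rw [if_pos ⟨by omega, h2⟩, Nat.sub_mul]
    have : 2 * (d * q) ≤ d * q * d := by
      rw [mul_comm]; exact Nat.mul_le_mul_left _ (by omega)
    omega

end Deficiency

/-! ### The exact gap between `|X|` and `s_k(n-1)` -/

section Total

theorem sum_nominalSize [NeZero k] (hn : 0 < n) (𝒞 : Finset (Set (Tuple k n)))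
    (h𝒞 : ∀ C, C ∈ 𝒞 ↔ C ∈ allNegaCircuits k n) :
    ((∑ C ∈ 𝒞, nominalSize n C.ncard : ℕ) : ℚ) =
      n * (((negaCircuits 0 n k).ncard : ℚ) + ((negaCircuits 2 n k).ncard : ℚ)) +
        oddPart n * (((negaCircuits 1 n k).ncard : ℚ) - delta k) + delta k := by
  classical
  have hcard : ∀ (P : Set (Tuple k n) → Prop) [DecidablePred P],
      {C ∈ allNegaCircuits k n | P C}.ncard = (𝒞.filter P).card := by
    intro P _
    rw [← Set.ncard_coe_finset]
    congr 1
    ext C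
    simp [h𝒞]
  have h1 : ∀ C ∈ 𝒞, (nominalSize n C.ncard : ℚ) =
      (if ¬ Odd C.ncard then (n : ℚ) else 0) + (if Odd C.ncard then (oddPart n : ℚ) else 0) +
        (if C.ncard = 1 then 1 - (oddPart n : ℚ) else 0) := by
    intro C _
    unfold nominalSize
    by_cases h1 : C.ncard = 1
    · simp [h1]
    · by_cases h2 : Odd C.ncard <;> simp [h1, h2]
  rw [Nat.cast_sum, Finset.sum_congr rfl h1, Finset.sum_add_distrib, Finset.sum_add_distrib,
    ← Finset.sum_filter, ← Finset.sum_filter, ← Finset.sum_filter, Finset.sum_const,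
    Finset.sum_const, Finset.sum_const, ← hcard, ← hcard, ← hcard, ← ncard_zero_add_two hn,
    ← negaCircuits_one_eq hn, ncard_allNegaCircuits_eq_one hn]
  simp only [nsmul_eq_mul]
  push_cast
  ring

theorem IsExtension.exists_eq_sBound_add [NeZero k] (hn : 0 < n) {X : Set (Tuple k n)}
    (hX : IsExtension k n X) :
    ∃ t : ℕ, (X.ncard : ℚ) = sBound k n + t ∧
      4 * t ≤ (n - 2) * ∑ d ∈ Finset.Icc 2 (n / 2), (k ^ d - k) := by
  classical
  let 𝒞 : Finset (Set (Tuple k n)) := (Set.toFinite (allNegaCircuits k n)).toFinset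
  have h𝒞 : ∀ C, C ∈ 𝒞 ↔ C ∈ allNegaCircuits k n := fun C => by simp [𝒞]
  have hdvd : ∀ C ∈ 𝒞, C.ncard ∣ n := by
    intro C hC
    obtain ⟨a, -, rfl⟩ := mem_allNegaCircuits_iff.1 ((h𝒞 C).1 hC)
    rw [ncard_circuit hn]
    exact shiftPeriod_dvd a
  have hclosed : ∀ a ∈ negaTuples k n, circuit a ⊆ negaTuples k n := by
    intro a ha b hb
    have h1 : circuit (-reverse b) = circuit (-reverse a) := by
      rw [← reverseComplement_circuit, ← reverseComplement_circuit, circuit_eq_of_mem hb]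
    change -reverse b ∈ circuit b
    rw [circuit_eq_of_mem hb, ← circuit_eq_iff, h1]
    exact circuit_eq_of_mem ha
  have hU : (negaTuples k n).ncard = ∑ C ∈ 𝒞, C.ncard :=
    ncard_eq_sum_circuits _ hclosed 𝒞 fun C => by rw [h𝒞, mem_allNegaCircuits_iff]
  -- The surplus is half the total deficiency; each summand is an integer because nominal and true
  -- lengths have the same parity.
  let t := ∑ C ∈ 𝒞, (nominalSize n C.ncard - C.ncard) / 2
  have h2t : 2 * t = ∑ C ∈ 𝒞, (nominalSize n C.ncard - C.ncard) := by
    rw [Finset.mul_sum]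
    exact Finset.sum_congr rfl fun C hC =>
      Nat.mul_div_cancel' (even_nominalSize_sub hn (hdvd C hC)).two_dvd
  have hsum : (negaTuples k n).ncard + 2 * t = ∑ C ∈ 𝒞, nominalSize n C.ncard := by
    rw [hU, h2t, ← Finset.sum_add_distrib]
    exact Finset.sum_congr rfl fun C hC => Nat.add_sub_cancel' (le_nominalSize hn (hdvd C hC))
  refine ⟨t, ?_, ?_⟩
  · have h1 := hX.two_mul_ncard_add
    have h2 := sum_nominalSize hn 𝒞 h𝒞
    rw [← hsum] at h2
    have h3 : (2 * X.ncard + (negaTuples k n).ncard : ℚ) = (k : ℚ) ^ n := by exact_mod_cast h1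
    push_cast at h2
    unfold sBound
    linarith
  -- Only circuits of length between `2` and `n / 2` are deficient. Their tuples are counted by
  -- least shift period `d`, with at most `k ^ d - k` for each `d`.
  · let A : Set (Tuple k n) := {a | 2 ≤ shiftPeriod a ∧ shiftPeriod a ≤ n / 2 ∧ a ∈ negaTuples k n}
    have hA : A.ncard = ∑ C ∈ 𝒞.filter fun C => 2 ≤ C.ncard ∧ C.ncard ≤ n / 2, C.ncard := by
      refine ncard_eq_sum_circuits A (fun a ha b hb => ?_) _ fun C => ?_
      · have hp : shiftPeriod b = shiftPeriod a := by
          rw [← ncard_circuit hn, ← ncard_circuit hn, circuit_eq_of_mem hb]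
        exact ⟨hp ▸ ha.1, hp ▸ ha.2.1, hclosed a ha.2.2 hb⟩
      · rw [Finset.mem_filter, h𝒞, mem_allNegaCircuits_iff]
        constructor
        · rintro ⟨⟨a, ha, rfl⟩, h1, h2⟩
          rw [ncard_circuit hn] at h1 h2
          exact ⟨a, ⟨h1, h2, ha⟩, rfl⟩
        · rintro ⟨a, ⟨h1, h2, ha⟩, rfl⟩
          rw [ncard_circuit hn]
          exact ⟨⟨a, ha, rfl⟩, h1, h2⟩
    have hA' : A.ncard ≤ ∑ d ∈ Finset.Icc 2 (n / 2), (k ^ d - k) := by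
      have hsub : A ⊆ ⋃ d ∈ Finset.Icc 2 (n / 2), {a : Tuple k n | shiftPeriod a = d} := by
        intro a ha
        simp only [Set.mem_iUnion]
        exact ⟨shiftPeriod a, Finset.mem_Icc.2 ⟨ha.1, ha.2.1⟩, rfl⟩
      refine (Set.ncard_le_ncard hsub).trans ((Finset.set_ncard_biUnion_le _ _).trans ?_)
      refine Finset.sum_le_sum fun d hd => ?_
      rw [Finset.mem_Icc] at hd
      exact ncard_shiftPeriod_eq_le d hd.1 (hd.2.trans (Nat.div_le_self _ _))
    calc 4 * t = ∑ C ∈ 𝒞, 2 * (nominalSize n C.ncard - C.ncard) := by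
          rw [← Finset.mul_sum, ← h2t]; ring
      _ ≤ ∑ C ∈ 𝒞, if 2 ≤ C.ncard ∧ C.ncard ≤ n / 2 then (n - 2) * C.ncard else 0 :=
          Finset.sum_le_sum fun C hC => two_mul_nominalSize_sub_le hn (hdvd C hC)
      _ = (n - 2) * A.ncard := by rw [← Finset.sum_filter, hA, Finset.mul_sum]
      _ ≤ _ := Nat.mul_le_mul_left _ hA'

end Total

theorem IsExtension.exists_orientable_sBound [Fact (2 < k)] (hn : 3 ≤ n) {X : Set (Tuple k n)}
    (hX : IsExtension k n X) :
    ∃ (s : ℕ → ZMod k) (p : ℕ), IsOrientableSequence (n + 1) s p ∧ (p : ℚ) = k * sBound k n := by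
  have hk := Fact.out (p := 2 < k)
  have : NeZero k := ⟨by omega⟩
  obtain ⟨t, ht, hle⟩ := hX.exists_eq_sBound_add (by omega)
  rcases Nat.eq_zero_or_pos t with rfl | ht0
  · obtain ⟨s, -, hs⟩ := hX.exists_eulerian_orientable (by omega)
    refine ⟨s, _, hs, ?_⟩
    rw [Nat.cast_mul, ht]; simp
  -- For `n = 3` the sum bounding `t` is empty, so `t = 0`.
  have hn4 : 4 ≤ n := by
    by_contra h
    have : n = 3 := by omega
    subst this
    simp at hle
    omega
  have hpow := hX.pow_le_four_mul_ncard hk (by omega)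
  have hcases := lt_or_core_le hk hn4 hpow hle
  -- This keeps the set left after the removal nonempty.
  have htX : t < X.ncard := by
    rcases hcases with h | h
    · have h1 := four_mul_le_three_pow (j := n) (by omega)
      have h2 : 3 ^ n ≤ k ^ n := Nat.pow_le_pow_left hk n
      omega
    · have : 0 < 2 ^ n := by positivity
      omega
  obtain ⟨s, hs⟩ := exists_orientable_of_ncard hn4 hX htX hcases
  refine ⟨s, _, hs, ?_⟩
  rw [Nat.cast_mul, Nat.cast_sub htX.le, ht]
  ring

end OrientableSeq

theorem mainTheorem5 (n k : ℕ) (hn : 3 ≤ n) (hk : 3 ≤ k) :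
    (∃ (s : ℕ → ZMod k) (p : ℕ), OrientableSeq.IsOrientableSequence (n + 1) s p ∧
      (p : ℚ) = k * OrientableSeq.sBound k n) ∧
    (∃ X : Set (OrientableSeq.Tuple k n), OrientableSeq.IsExtension k n X) ∧
    (∀ X : Set (OrientableSeq.Tuple k n), OrientableSeq.IsExtension k n X →
      ∃ (s : ℕ → ZMod k) (p : ℕ),
        OrientableSeq.IsEulerianCircuit (OrientableSeq.lempel ⁻¹' X) p
          (OrientableSeq.window s (n + 1)) ∧
        OrientableSeq.IsOrientableSequence (n + 1) s p ∧
        p = k * X.ncard ∧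
        (k : ℚ) * OrientableSeq.sBound k n ≤ p) := by
  have : Fact (2 < k) := ⟨hk⟩
  have : NeZero k := ⟨by omega⟩
  obtain ⟨X, hX⟩ := OrientableSeq.exists_isExtension (k := k) (n := n)
  refine ⟨hX.exists_orientable_sBound hn, ⟨X, hX⟩, fun X hX => ?_⟩
  obtain ⟨s, he, ho⟩ := hX.exists_eulerian_orientable (by omega)
  obtain ⟨t, ht, -⟩ := hX.exists_eq_sBound_add (by omega)
  refine ⟨s, _, he, ho, rfl, ?_⟩
  rw [Nat.cast_mul, ht]
  refine mul_le_mul_of_nonneg_left ?_ (Nat.cast_nonneg k)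
  linarith [(Nat.cast_nonneg t : (0 : ℚ) ≤ t)]
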